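/- Let $A\in\mathbb R^{n\times n}$, $B^W\in\mathbb R^{n\times n_W}$, $B^P\in\mathbb R^{n\times n_P}$, $H\in\mathbb R^{m\times n}$, let $p\in[0,1]$, and let $Q_v\in\mathbb R^{m\times m}$ be positive semidefinite. Put $B=\begin{bmatrix}B^W & B^P\end{bmatrix}$ and $R=\begin{bmatrix}R^W&0\\0&R^P\end{bmatrix}$. Consider the system without additive process noise $$x_{k+1}=Ax_k+Bu_k+B^P\tilde u^P_k,\qquad k\ge 0,$$ with observations $y^W_k=\beta_kx_k$ (remote controller) and $y^P_k=Hx_k+v_k$ (embedded controller). Here $x_0$ is Gaussian; $(v_k)$ is an i.i.d. sequence of centred Gaussian vectors with covariance $Q_v$; $(\beta_k)$ is i.i.d. with $\mathbb P(\beta_k=0)=p$ and $\mathbb P(\beta_k=1)=1-p$; and $x_0$, $(v_k)$, $(\beta_k)$ are mutually independent. Let $\mathcal F\{Y^W_k\}=\sigma(y^W_0,\dots,y^W_k)$, $\mathcal F\{Y^W_k,Y^P_k\}=\sigma(y^W_0,\dots,y^W_k,y^P_0,\dots,y^P_k)$, $\hat x^W_{k|k}=\mathbb E[x_k\mid\mathcal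 F\{Y^W_k\}]$ and $\hat x^P_{k|k}=\mathbb E[x_k\mid\mathcal F\{Y^W_k,Y^P_k\}]$. The system is called mean-square stabilizable if there are constant matrices $L^W\in\mathbb R^{(n_W+n_P)\times n}$ and $L^P\in\mathbb R^{n_P\times n}$ such that, for every Gaussian initial value $x_0$ (arbitrary mean and arbitrary positive semidefinite covariance), the closed loop obtained with $u_k=L^W\hat x^W_{k|k}$ and $\tilde u^P_k=L^P(\hat x^P_{k|k}-\hat x^W_{k|k})$ satisfies $\lim_{k\to\infty}\mathbb E(x_k'x_k)=0$. Theorem. Assume that $R^W>0$, $R^P>0$ and $Q=D'D\ge 0$ for some matrix $D$; that $(A,Q^{1/2})$ is observable; and that $(A,H)$ is detectable. If the system is mean-square stabilizable, then there exist $n\times n$ real matrices $P^W$ and $P^P$ that solve $$P^W=A'P^WA-M'\Gamma^{-1}M+Q,\qquad P^P=A'\Delta A-L'\Omega^{-1}L+Q,$$ where $$\Gamma=B'P^WB+R,\quad M=B'P^WA,\quad \Omega=B^{P\prime}\Delta B^P+R^P,\quad L=B^{P\prime}\Delta A,\quad \Delta=(1-p)P^W+pP^P,$$ and that satisfy $P^W>0$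 and $\Delta>0$ (symmetric positive definite). -/

import Mathlib

open MeasureTheory ProbabilityTheory Filter Topology
open scoped Matrix MatrixOrder

namespace NCS

/-! ### Linear-systems notions -/

/-- A real square matrix is (discrete-time) asymptotically stable: all its complex eigenvalues
lie in the open unit disc. -/
def IsSchurStable {n : ℕ} (A : Matrix (Fin n) (Fin n) ℝ) : Prop :=
  ∀ z ∈ spectrum ℂ (A.map (algebraMap ℝ ℂ)), ‖z‖ < 1

/-- `(A, C)` is observable: the only initial state of `x (k+1) = A x k` whose output `C x k`
vanishes at all times is `0`. -/
def IsObservable {n r : ℕ} (A : Matrix (Fin n) (Fin n) ℝ) (C : Matrix (Fin r) (Fin n) ℝ) : Prop :=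
  ∀ x : Fin n → ℝ, (∀ k : ℕ, C *ᵥ (A ^ k *ᵥ x) = 0) → x = 0

/-- `(A, C)` is detectable: some output injection makes `A` stable. -/
def IsDetectable {n r : ℕ} (A : Matrix (Fin n) (Fin n) ℝ) (C : Matrix (Fin r) (Fin n) ℝ) : Prop :=
  ∃ K : Matrix (Fin n) (Fin r) ℝ, IsSchurStable (A - K * C)

/-- The combined input matrix `B = [B^W  B^P]`. -/
def combinedB {n nW nP : ℕ} (BW : Matrix (Fin n) (Fin nW) ℝ) (BP : Matrix (Fin n) (Fin nP) ℝ) :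
    Matrix (Fin n) (Fin nW ⊕ Fin nP) ℝ :=
  Matrix.fromCols BW BP

/-- The combined weight `R = diag(R^W, R^P)`. -/
def combinedR {nW nP : ℕ} (RW : Matrix (Fin nW) (Fin nW) ℝ) (RP : Matrix (Fin nP) (Fin nP) ℝ) :
    Matrix (Fin nW ⊕ Fin nP) (Fin nW ⊕ Fin nP) ℝ :=
  Matrix.fromBlocks RW 0 0 RP

/-! ### The stochastic system

`Ω` is the sample space, `x k` the state, `v k` the observation noise of the embedded controller
and `β k ∈ {0, 1}` the arrival indicator of the channel to the remote controller. -/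

section System

variable {n m nW nP : ℕ} {Ω : Type}

/-- Observation of the remote controller, `y^W_k = β_k x_k`. -/
def yW (β : ℕ → Ω → ℝ) (x : ℕ → Ω → EuclideanSpace ℝ (Fin n)) (k : ℕ) (ω : Ω) :
    EuclideanSpace ℝ (Fin n) :=
  β k ω • x k ω

/-- Observation of the embedded controller, `y^P_k = H x_k + v_k`. -/
noncomputable def yP (H : Matrix (Fin m) (Fin n) ℝ) (v : ℕ → Ω → EuclideanSpace ℝ (Fin m))
    (x : ℕ → Ω → EuclideanSpace ℝ (Fin n)) (k : ℕ) (ω : Ω) : EuclideanSpace ℝ (Fin m) :=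
  Matrix.toEuclideanLin H (x k ω) + v k ω

/-- The σ-algebra generated by `y^W_0, …, y^W_k`. -/
@[reducible] def sigmaW (β : ℕ → Ω → ℝ) (x : ℕ → Ω → EuclideanSpace ℝ (Fin n)) (k : ℕ) : MeasurableSpace Ω :=
  ⨆ j ≤ k, MeasurableSpace.comap (yW β x j) inferInstance

/-- The σ-algebra generated by `y^W_0, …, y^W_k, y^P_0, …, y^P_k`. -/
@[reducible] noncomputable def sigmaP (H : Matrix (Fin m) (Fin n) ℝ) (v : ℕ → Ω → EuclideanSpace ℝ (Fin m))
    (β : ℕ → Ω → ℝ) (x : ℕ → Ω → EuclideanSpace ℝ (Fin n)) (k : ℕ) : MeasurableSpace Ω :=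
  sigmaW β x k ⊔ ⨆ j ≤ k, MeasurableSpace.comap (yP H v x j) inferInstance

/-- The optimal estimate of the state by the remote controller, `E[x_k | y^W_0, …, y^W_k]`. -/
noncomputable def estW [MeasurableSpace Ω] (P : Measure Ω)
    (β : ℕ → Ω → ℝ) (x : ℕ → Ω → EuclideanSpace ℝ (Fin n)) (k : ℕ) :
    Ω → EuclideanSpace ℝ (Fin n) :=
  P[x k | sigmaW β x k]

/-- The optimal estimate of the state by the embedded controller,
`E[x_k | y^W_0, …, y^W_k, y^P_0, …, y^P_k]`. -/
noncomputable def estP [MeasurableSpace Ω] (P : Measure Ω)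
    (H : Matrix (Fin m) (Fin n) ℝ) (v : ℕ → Ω → EuclideanSpace ℝ (Fin m))
    (β : ℕ → Ω → ℝ) (x : ℕ → Ω → EuclideanSpace ℝ (Fin n)) (k : ℕ) :
    Ω → EuclideanSpace ℝ (Fin n) :=
  P[x k | sigmaP H v β x k]

/-- The random data: `x0 ~ N(μ, σ)`, `v` is Gaussian white noise with covariance `Qv`, `β` is an
i.i.d. Bernoulli sequence with `P(β_k = 0) = p`, and `x0`, `v`, `β` are mutually independent. -/
structure IsRandomData [MeasurableSpace Ω] (P : Measure Ω) (μ : EuclideanSpace ℝ (Fin n))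
    (σ : Matrix (Fin n) (Fin n) ℝ) (Qv : Matrix (Fin m) (Fin m) ℝ) (p : ℝ)
    (x0 : Ω → EuclideanSpace ℝ (Fin n)) (v : ℕ → Ω → EuclideanSpace ℝ (Fin m))
    (β : ℕ → Ω → ℝ) : Prop where
  measurable_x0 : Measurable x0
  measurable_v : ∀ k, Measurable (v k)
  measurable_β : ∀ k, Measurable (β k)
  law_x0 : HasLaw x0 (multivariateGaussian μ σ) P
  law_v : ∀ k, HasLaw (v k) (multivariateGaussian 0 Qv) P
  β_mem : ∀ k ω, β k ω = 0 ∨ β k ω = 1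
  prob_loss : ∀ k, P {ω | β k ω = 0} = ENNReal.ofReal p
  prob_arrival : ∀ k, P {ω | β k ω = 1} = ENNReal.ofReal (1 - p)
  indep_v : iIndepFun v P
  indep_β : iIndepFun β P
  indep_v_β : IndepFun (fun ω k => v k ω) (fun ω k => β k ω) P
  indep_x0 : IndepFun x0 (fun ω => ((fun k => v k ω), (fun k => β k ω))) P

/-- `x` is the closed-loop trajectory of `x_{k+1} = A x_k + B u_k + B^P ũ^P_k` from `x0` with
`u_k = L^W x̂^W_{k|k}` and `ũ^P_k = L^P (x̂^P_{k|k} - x̂^W_{k|k})`. -/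
structure IsClosedLoop [MeasurableSpace Ω] (P : Measure Ω)
    (A : Matrix (Fin n) (Fin n) ℝ) (BW : Matrix (Fin n) (Fin nW) ℝ) (BP : Matrix (Fin n) (Fin nP) ℝ)
    (H : Matrix (Fin m) (Fin n) ℝ)
    (LW : Matrix (Fin nW ⊕ Fin nP) (Fin n) ℝ) (LP : Matrix (Fin nP) (Fin n) ℝ)
    (x0 : Ω → EuclideanSpace ℝ (Fin n)) (v : ℕ → Ω → EuclideanSpace ℝ (Fin m))
    (β : ℕ → Ω → ℝ) (x : ℕ → Ω → EuclideanSpace ℝ (Fin n)) : Prop where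
  init : x 0 = x0
  step : ∀ k ω, x (k + 1) ω =
    Matrix.toEuclideanLin A (x k ω)
      + Matrix.toEuclideanLin (combinedB BW BP) (Matrix.toEuclideanLin LW (estW P β x k ω))
      + Matrix.toEuclideanLin BP
          (Matrix.toEuclideanLin LP (estP P H v β x k ω - estW P β x k ω))

end System

/-- Mean-square stabilizability of the system without additive process noise: there are constant
gains `L^W`, `L^P` such that, for every Gaussian initial value, the closed loop satisfies
`E[x_k' x_k] → 0`. -/
def IsMeanSquareStabilizable {n m nW nP : ℕ} (A : Matrix (Fin n) (Fin n) ℝ)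
    (BW : Matrix (Fin n) (Fin nW) ℝ) (BP : Matrix (Fin n) (Fin nP) ℝ)
    (H : Matrix (Fin m) (Fin n) ℝ) (Qv : Matrix (Fin m) (Fin m) ℝ) (p : ℝ) : Prop :=
  ∃ (LW : Matrix (Fin nW ⊕ Fin nP) (Fin n) ℝ) (LP : Matrix (Fin nP) (Fin n) ℝ),
    ∀ (μ : EuclideanSpace ℝ (Fin n)) (σ : Matrix (Fin n) (Fin n) ℝ), σ.PosSemidef →
    ∀ (Ω : Type) [MeasurableSpace Ω] (P : Measure Ω) [IsProbabilityMeasure P]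
      (x0 : Ω → EuclideanSpace ℝ (Fin n)) (v : ℕ → Ω → EuclideanSpace ℝ (Fin m))
      (β : ℕ → Ω → ℝ) (x : ℕ → Ω → EuclideanSpace ℝ (Fin n)),
      IsRandomData P μ σ Qv p x0 v β →
      IsClosedLoop P A BW BP H LW LP x0 v β x →
      Tendsto (fun k => ∫⁻ ω, ‖x k ω‖ₑ ^ 2 ∂P) atTop (𝓝 0)

/-! ### The coupled algebraic Riccati equations -/

section Riccati

variable {n nW nP : ℕ}

/-- `Γ = B' P^W B + R`. -/
def Gam (BW : Matrix (Fin n) (Fin nW) ℝ) (BP : Matrix (Fin n) (Fin nP) ℝ)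
    (RW : Matrix (Fin nW) (Fin nW) ℝ) (RP : Matrix (Fin nP) (Fin nP) ℝ)
    (PW : Matrix (Fin n) (Fin n) ℝ) : Matrix (Fin nW ⊕ Fin nP) (Fin nW ⊕ Fin nP) ℝ :=
  (combinedB BW BP)ᵀ * PW * combinedB BW BP + combinedR RW RP

/-- `M = B' P^W A`. -/
def Mmat (A : Matrix (Fin n) (Fin n) ℝ) (BW : Matrix (Fin n) (Fin nW) ℝ)
    (BP : Matrix (Fin n) (Fin nP) ℝ) (PW : Matrix (Fin n) (Fin n) ℝ) :
    Matrix (Fin nW ⊕ Fin nP) (Fin n) ℝ :=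
  (combinedB BW BP)ᵀ * PW * A

/-- `Δ = (1 - p) P^W + p P^P`. -/
def Del (p : ℝ) (PW PP : Matrix (Fin n) (Fin n) ℝ) : Matrix (Fin n) (Fin n) ℝ :=
  (1 - p) • PW + p • PP

/-- `Ω = B^P' Δ B^P + R^P`. -/
def Omg (BP : Matrix (Fin n) (Fin nP) ℝ) (RP : Matrix (Fin nP) (Fin nP) ℝ)
    (Δ : Matrix (Fin n) (Fin n) ℝ) : Matrix (Fin nP) (Fin nP) ℝ :=
  BPᵀ * Δ * BP + RP

/-- `L = B^P' Δ A`. -/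
def Lmat (A : Matrix (Fin n) (Fin n) ℝ) (BP : Matrix (Fin n) (Fin nP) ℝ)
    (Δ : Matrix (Fin n) (Fin n) ℝ) : Matrix (Fin nP) (Fin n) ℝ :=
  BPᵀ * Δ * A

/-- `P^W = A' P^W A - M' Γ⁻¹ M + Q`. -/
def RiccatiW (A : Matrix (Fin n) (Fin n) ℝ) (BW : Matrix (Fin n) (Fin nW) ℝ)
    (BP : Matrix (Fin n) (Fin nP) ℝ) (Q : Matrix (Fin n) (Fin n) ℝ)
    (RW : Matrix (Fin nW) (Fin nW) ℝ) (RP : Matrix (Fin nP) (Fin nP) ℝ)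
    (PW : Matrix (Fin n) (Fin n) ℝ) : Prop :=
  PW = Aᵀ * PW * A - (Mmat A BW BP PW)ᵀ * (Gam BW BP RW RP PW)⁻¹ * Mmat A BW BP PW + Q

/-- `P^P = A' Δ A - L' Ω⁻¹ L + Q`. -/
def RiccatiP (A : Matrix (Fin n) (Fin n) ℝ) (BP : Matrix (Fin n) (Fin nP) ℝ)
    (Q : Matrix (Fin n) (Fin n) ℝ) (RP : Matrix (Fin nP) (Fin nP) ℝ) (p : ℝ)
    (PW PP : Matrix (Fin n) (Fin n) ℝ) : Prop :=
  PP = Aᵀ * Del p PW PP * A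
    - (Lmat A BP (Del p PW PP))ᵀ * (Omg BP RP (Del p PW PP))⁻¹ * Lmat A BP (Del p PW PP) + Q

end Riccati

end NCS

namespace NCS

/-! ### The Hautus test by square-summable steering over ℂ. -/

section Stabilizable

/-! The coupled equations decouple. The first is an ordinary Riccati equation for `P^W` with input
matrix `B`. Multiplying the second by `p` and adding `(1 - p) P^W` gives an ordinary Riccati
equation for `Δ` alone, with dynamics `√p A`, input `B^P` and state weight `pQ + (1 - p)P^W`; then
`P^P` is read off from `Δ`.

`exists_posDef_riccatiMap_eq` solves each of them. Value iteration from `0` increases, and it is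
bounded because every initial state has a trajectory of finite cost; the limit is a fixed point,
positive definite by observability. Finite cost comes from the Hautus test
(`stabilizableStates_eq_top`).

It remains to derive the two Hautus conditions from mean-square stability. A left eigenvector `a` of
`A` with eigenvalue `c`, `|c| ≥ 1`, that annihilates `B` gives `a(x_k) = c^k a(x_0)`, which cannot
tend to `0` for a standard Gaussian `x_0` unless `a = 0`. For the pair `(√p A, B^P)`, restrict to
the event, of probability `p^k`, that the first `k` packets are lost. There the remote estimate is
deterministic, so a left eigenvector of `A` annihilating `B^P` satisfies `a(x_k) = c^k a(x_0) + d`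
with `d` constant. The shift cannot lower the second moment, by Gaussian symmetry, and `p |c|² ≥ 1`
makes the growth compensate for the rarity of the event (`lintegral_le_of_annihilates`). -/

theorem summable_norm_sq_add {E : Type*} [SeminormedAddCommGroup E] {a b : ℕ → E}
    (ha : Summable fun k => ‖a k‖ ^ 2) (hb : Summable fun k => ‖b k‖ ^ 2) :
    Summable fun k => ‖a k + b k‖ ^ 2 := by
  refine Summable.of_nonneg_of_le (fun k => by positivity) (fun k => ?_)
    ((ha.mul_left 2).add (hb.mul_left 2))
  have h := norm_add_le (a k) (b k)
  nlinarith [sq_nonneg (‖a k‖ - ‖b k‖), norm_nonneg (a k + b k), norm_nonneg (a k),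
    norm_nonneg (b k)]

/-- A sequence driven by a square-summable input through a strict contraction is
square-summable. -/
theorem summable_sq_of_le_mul_add {a b : ℕ → ℝ} {r : ℝ} (hr0 : 0 ≤ r) (hr1 : r < 1)
    (ha : ∀ k, 0 ≤ a k) (hab : ∀ k, a (k + 1) ≤ r * a k + b k)
    (hb : Summable fun k => b k ^ 2) : Summable fun k => a k ^ 2 := by
  have hr : 0 < 1 - r := by linarith
  -- Convexity of the square with weights `r` and `1 - r`, applied to `a k` and `b k / (1 - r)`.
  have step (k : ℕ) : a (k + 1) ^ 2 ≤ r * a k ^ 2 + b k ^ 2 / (1 - r) := by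
    have h1 : a (k + 1) ^ 2 ≤ (r * a k + b k) ^ 2 := pow_le_pow_left₀ (ha _) (hab k) 2
    have h2 : r * a k ^ 2 + b k ^ 2 / (1 - r) - (r * a k + b k) ^ 2
        = r / (1 - r) * ((1 - r) * a k - b k) ^ 2 := by
      field_simp
      ring
    have h3 : 0 ≤ r / (1 - r) * ((1 - r) * a k - b k) ^ 2 := by positivity
    linarith
  set C : ℝ := a 0 ^ 2 + (∑' k, b k ^ 2) / (1 - r) with hC
  refine summable_of_sum_range_le (c := C / (1 - r)) (fun k => sq_nonneg _) (fun N => ?_)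
  have h1 : ∑ k ∈ Finset.range (N + 1), a k ^ 2
      ≤ a 0 ^ 2 + (r * ∑ k ∈ Finset.range N, a k ^ 2 + (∑' k, b k ^ 2) / (1 - r)) := by
    rw [Finset.sum_range_succ', add_comm]
    gcongr
    calc ∑ k ∈ Finset.range N, a (k + 1) ^ 2
        ≤ ∑ k ∈ Finset.range N, (r * a k ^ 2 + b k ^ 2 / (1 - r)) :=
          Finset.sum_le_sum fun k _ => step k
      _ = r * ∑ k ∈ Finset.range N, a k ^ 2 + (∑ k ∈ Finset.range N, b k ^ 2) / (1 - r) := by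
          rw [Finset.sum_add_distrib, Finset.mul_sum, Finset.sum_div]
      _ ≤ _ := by
          gcongr
          exact hb.sum_le_tsum _ fun _ _ => sq_nonneg _
  rw [Finset.sum_range_succ] at h1
  rw [le_div_iff₀ hr]
  nlinarith [sq_nonneg (a N)]

variable {E U : Type*} [NormedAddCommGroup E] [NormedSpace ℂ E]
  [NormedAddCommGroup U] [NormedSpace ℂ U]

/-- The states from which `x (k+1) = f (x k) + g (u k)` can be steered with square-summable state
and input. -/
def stabilizableStates (f : E →ₗ[ℂ] E) (g : U →ₗ[ℂ] E) : Submodule ℂ E where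
  carrier := {x | ∃ (z : ℕ → E) (u : ℕ → U), z 0 = x ∧ (∀ k, z (k + 1) = f (z k) + g (u k)) ∧
    (Summable fun k => ‖z k‖ ^ 2) ∧ Summable fun k => ‖u k‖ ^ 2}
  zero_mem' := ⟨0, 0, by simp, by simp, by simp, by simp⟩
  add_mem' := by
    rintro x y ⟨z, u, h0, h, hz, hu⟩ ⟨z', u', h0', h', hz', hu'⟩
    refine ⟨z + z', u + u', by simp [h0, h0'], fun k => ?_, summable_norm_sq_add hz hz',
      summable_norm_sq_add hu hu'⟩
    simp only [Pi.add_apply, h, h', map_add]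
    abel
  smul_mem' := by
    rintro c x ⟨z, u, h0, h, hz, hu⟩
    refine ⟨c • z, c • u, by simp [h0], fun k => by simp [h], ?_, ?_⟩
    · simpa [norm_smul, mul_pow] using hz.mul_left (‖c‖ ^ 2)
    · simpa [norm_smul, mul_pow] using hu.mul_left (‖c‖ ^ 2)

theorem mem_stabilizableStates_iff_exists_step {f : E →ₗ[ℂ] E} {g : U →ₗ[ℂ] E} {x : E} :
    x ∈ stabilizableStates f g ↔ ∃ u, f x + g u ∈ stabilizableStates f g := by
  constructor
  · rintro ⟨z, u, rfl, h, hz, hu⟩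
    exact ⟨u 0, fun k => z (k + 1), fun k => u (k + 1), h 0, fun k => h (k + 1),
      (summable_nat_add_iff 1).2 hz, (summable_nat_add_iff 1).2 hu⟩
  · rintro ⟨w, z, u, h0, h, hz, hu⟩
    refine ⟨fun k => Nat.casesOn k x z, fun k => Nat.casesOn k w u, rfl, ?_, ?_, ?_⟩
    · rintro (_ | k)
      · exact h0
      · exact h k
    · exact (summable_nat_add_iff 1).1 hz
    · exact (summable_nat_add_iff 1).1 hu

theorem comap_stabilizableStates_sup_range (f : E →ₗ[ℂ] E) (g : U →ₗ[ℂ] E) :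
    (stabilizableStates f g ⊔ LinearMap.range g).comap f = stabilizableStates f g := by
  ext x
  rw [Submodule.mem_comap, Submodule.mem_sup, mem_stabilizableStates_iff_exists_step]
  constructor
  · rintro ⟨v, hv, _, ⟨u, rfl⟩, h⟩
    exact ⟨-u, by rw [map_neg, ← h]; simpa using hv⟩
  · rintro ⟨u, hu⟩
    exact ⟨_, hu, g (-u), ⟨-u, rfl⟩, by simp⟩

/-- Dimension count: `f` induces a map `E → E ⧸ (V ⊔ range g)` with kernel exactly `V`, so `V ⊔
range g` cannot have larger dimension than `V`. -/
theorem range_le_stabilizableStates [FiniteDimensional ℂ E] (f : E →ₗ[ℂ] E) (g : U →ₗ[ℂ] E) :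
    LinearMap.range g ≤ stabilizableStates f g := by
  set V := stabilizableStates f g with hV
  set W := V ⊔ LinearMap.range g with hW
  have hker : LinearMap.ker (W.mkQ ∘ₗ f) = V := by
    rw [LinearMap.ker_comp, Submodule.ker_mkQ]
    exact comap_stabilizableStates_sup_range f g
  have h1 := LinearMap.finrank_range_add_finrank_ker (W.mkQ ∘ₗ f)
  have h2 := Submodule.finrank_quotient_add_finrank W
  have h3 := Submodule.finrank_le (LinearMap.range (W.mkQ ∘ₗ f))
  rw [hker] at h1
  have h4 : V = W := Submodule.eq_of_le_of_finrank_le le_sup_left (by omega)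
  rw [h4]
  exact le_sup_right

/-- Filtering a steering pair for `f x - c • x` through `s ↦ c • s + ·` gives one for `x`; for `‖c‖
< 1` the filter preserves square-summability. -/
theorem mem_stabilizableStates_of_map_sub_smul_mem {f : E →ₗ[ℂ] E} {g : U →ₗ[ℂ] E} {c : ℂ}
    (hc : ‖c‖ < 1) {x : E} (hx : f x - c • x ∈ stabilizableStates f g) :
    x ∈ stabilizableStates f g := by
  obtain ⟨z, u, h0, h, hz, hu⟩ := hx
  let y : ℕ → E := fun k => Nat.rec x (fun k s => c • s + z k) k
  let w : ℕ → U := fun k => Nat.rec 0 (fun k s => c • s + u k) k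
  have hy (k : ℕ) : y (k + 1) = c • y k + z k := rfl
  have hw (k : ℕ) : w (k + 1) = c • w k + u k := rfl
  refine ⟨y, w, rfl, fun k => ?_, ?_, ?_⟩
  · induction k with
    | zero =>
      rw [hy, h0]
      simp [y, w]
    | succ k ih =>
      calc y (k + 1 + 1) = c • (f (y k) + g (w k)) + (f (z k) + g (u k)) := by
            rw [hy (k + 1), ih, h]
        _ = f (c • y k + z k) + g (c • w k + u k) := by
            simp only [map_add, map_smul, smul_add]
            abel
        _ = _ := by rw [← hy, ← hw]
  · refine summable_sq_of_le_mul_add (norm_nonneg c) hc (fun k => norm_nonneg _) (fun k => ?_) hz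
    rw [hy, ← norm_smul]
    exact norm_add_le _ _
  · refine summable_sq_of_le_mul_add (norm_nonneg c) hc (fun k => norm_nonneg _) (fun k => ?_) hu
    rw [hw, ← norm_smul]
    exact norm_add_le _ _

/-- The Hautus test: if no nonzero left eigenvector for an eigenvalue outside the open unit disc
annihilates the input, every state can be stabilized. -/
theorem stabilizableStates_eq_top [FiniteDimensional ℂ E] (f : E →ₗ[ℂ] E) (g : U →ₗ[ℂ] E)
    (H : ∀ (c : ℂ) (ψ : E →ₗ[ℂ] ℂ), 1 ≤ ‖c‖ → (∀ x, ψ (f x) = c * ψ x) → (∀ u, ψ (g u) = 0) →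
      ψ = 0) :
    stabilizableStates f g = ⊤ := by
  set V := stabilizableStates f g with hV
  by_contra hne
  have hrange : LinearMap.range g ≤ V := range_le_stabilizableStates f g
  have hinv : V ≤ V.comap f := by
    have := comap_stabilizableStates_sup_range f g
    rw [sup_eq_left.2 hrange] at this
    exact this.ge
  have : Nontrivial (E ⧸ V) := Submodule.Quotient.nontrivial_iff.2 hne
  obtain ⟨c, hc⟩ := Module.End.exists_eigenvalue (V.mapQ V f hinv)
  obtain ⟨xb, hxb⟩ := hc.exists_hasEigenvector
  set F : (E ⧸ V) →ₗ[ℂ] (E ⧸ V) := V.mapQ V f hinv - c • LinearMap.id with hF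
  have hFx : F xb = 0 := by simp [hF, hxb.apply_eq_smul]
  have hnotinj : ¬ Function.Injective F := fun hinj =>
    hxb.2 (hinj (by rw [hFx, map_zero]))
  have hlt : LinearMap.range F < ⊤ := by
    rw [lt_top_iff_ne_top]
    intro htop
    exact hnotinj (LinearMap.injective_iff_surjective.2 (LinearMap.range_eq_top.1 htop))
  -- A functional vanishing on the range of `F` is a left eigenvector of the quotient map. Pulled
  -- back to `E` it kills `range g ≤ V`, so the hypothesis `H` forces `‖c‖ < 1`.
  obtain ⟨φ, hφ, hφF⟩ := Submodule.exists_le_ker_of_lt_top _ hlt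
  have hc1 : ‖c‖ < 1 := by
    by_contra! hc1
    have hψ := H c (φ ∘ₗ V.mkQ) hc1 (fun x => ?_) (fun u => ?_)
    · apply hφ
      ext x
      exact LinearMap.congr_fun hψ x
    · have := hφF ⟨V.mkQ x, rfl⟩
      simp only [hF, LinearMap.mem_ker, LinearMap.sub_apply, Submodule.mkQ_apply,
        Submodule.mapQ_apply, LinearMap.smul_apply, LinearMap.id_apply, map_sub, map_smul,
        smul_eq_mul] at this
      simpa using sub_eq_zero.1 this
    · have : V.mkQ (g u) = 0 := by
        simpa using hrange ⟨u, rfl⟩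
      rw [LinearMap.comp_apply, this, map_zero]
  obtain ⟨x, rfl⟩ := V.mkQ_surjective xb
  refine hxb.2 ?_
  rw [Submodule.mkQ_apply, Submodule.Quotient.mk_eq_zero]
  apply mem_stabilizableStates_of_map_sub_smul_mem hc1
  rw [← hV, ← Submodule.Quotient.mk_eq_zero]
  simpa [hF] using hFx

end Stabilizable

/-! ### Descent from complex to real trajectories. -/

theorem re_map_ofReal_mulVec {m k : Type*} [Fintype k] (M : Matrix m k ℝ) (y : k → ℂ) (i : m) :
    ((M.map Complex.ofReal *ᵥ y) i).re = (M *ᵥ fun j => (y j).re) i := by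
  simp [Matrix.mulVec, dotProduct]

theorem map_ofReal_mulVec_ofReal {m k : Type*} [Fintype k] (M : Matrix m k ℝ) (y : k → ℝ) :
    M.map Complex.ofReal *ᵥ (fun j => (y j : ℂ)) = fun i => (((M *ᵥ y) i : ℝ) : ℂ) := by
  ext i
  simp [Matrix.mulVec, dotProduct]

theorem norm_re_le_norm {m : Type*} [Fintype m] (y : m → ℂ) : ‖fun j => (y j).re‖ ≤ ‖y‖ :=
  (pi_norm_le_iff_of_nonneg (norm_nonneg _)).2 fun j =>
    (Complex.abs_re_le_norm _).trans (norm_le_pi_norm y j)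

/-- The real matrix form of the Hautus test, giving square-summable real trajectories. -/
theorem exists_summable_trajectory {n ι : Type*} [Fintype n] [Fintype ι]
    (A : Matrix n n ℝ) (B : Matrix n ι ℝ)
    (H : ∀ (c : ℂ) (a : (n → ℝ) →ₗ[ℝ] ℂ), 1 ≤ ‖c‖ → (∀ x, a (A *ᵥ x) = c * a x) →
      (∀ u, a (B *ᵥ u) = 0) → a = 0) (x : n → ℝ) :
    ∃ (z : ℕ → n → ℝ) (u : ℕ → ι → ℝ), z 0 = x ∧ (∀ k, z (k + 1) = A *ᵥ z k + B *ᵥ u k) ∧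
      (Summable fun k => ‖z k‖ ^ 2) ∧ Summable fun k => ‖u k‖ ^ 2 := by
  classical
  have htop := stabilizableStates_eq_top (Matrix.toLin' (A.map Complex.ofReal))
    (Matrix.toLin' (B.map Complex.ofReal)) (fun c ψ hc hA hB => by
      have h0 := H c ((ψ.restrictScalars ℝ) ∘ₗ Complex.ofRealCLM.toLinearMap.compLeft n) hc
        (fun y => by
          have := hA (fun j => (y j : ℂ))
          rw [Matrix.toLin'_apply, map_ofReal_mulVec_ofReal] at this
          exact this)
        (fun y => by
          have := hB (fun j => (y j : ℂ))
          rw [Matrix.toLin'_apply, map_ofReal_mulVec_ofReal] at this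
          exact this)
      -- `H` only gives vanishing on real vectors; the standard basis is real, and `ψ` is complex
      -- linear.
      refine LinearMap.pi_ext' fun i => LinearMap.ext_ring ?_
      have h1 := LinearMap.congr_fun h0 (Pi.single i 1)
      refine Eq.trans (congrArg ψ ?_) h1
      ext j
      by_cases h : j = i
      · subst h; simp
      · simp [h])
  obtain ⟨z, u, h0, h, hz, hu⟩ :
      (fun j => (x j : ℂ)) ∈ stabilizableStates (Matrix.toLin' (A.map Complex.ofReal))
        (Matrix.toLin' (B.map Complex.ofReal)) := htop ▸ Submodule.mem_top
  refine ⟨fun k j => (z k j).re, fun k j => (u k j).re, ?_, fun k => ?_, ?_, ?_⟩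
  · ext j
    simp [h0]
  · ext j
    change (z (k + 1) j).re = _
    rw [h k, Pi.add_apply, Pi.add_apply, Complex.add_re, Matrix.toLin'_apply,
      Matrix.toLin'_apply, re_map_ofReal_mulVec,
      re_map_ofReal_mulVec]
  · exact hz.of_nonneg_of_le (fun k => by positivity) fun k => by gcongr; exact norm_re_le_norm _
  · exact hu.of_nonneg_of_le (fun k => by positivity) fun k => by gcongr; exact norm_re_le_norm _

/-! ### The algebraic Riccati equation by value iteration. -/

section AlgebraicRiccati

theorem posDef_input_weight {n ι : Type*} [Fintype n] [Fintype ι] {B : Matrix n ι ℝ}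
    {P : Matrix n n ℝ} {R : Matrix ι ι ℝ} (hR : R.PosDef) (hP : P.PosSemidef) :
    (Bᵀ * P * B + R).PosDef := by
  have := hP.conjTranspose_mul_mul_same B
  rw [Matrix.conjTranspose_eq_transpose_of_trivial] at this
  exact hR.posSemidef_add this

theorem transpose_eq_of_isHermitian {n : Type*} {P : Matrix n n ℝ} (hP : P.IsHermitian) :
    Pᵀ = P := by
  rw [← Matrix.conjTranspose_eq_transpose_of_trivial]
  exact hP

theorem quadratic_nonneg {n : Type*} [Fintype n] {P : Matrix n n ℝ} (hP : P.PosSemidef)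
    (x : n → ℝ) : 0 ≤ x ⬝ᵥ P *ᵥ x := by
  simpa using hP.dotProduct_mulVec_nonneg x

theorem exists_quadratic_le {m : Type*} [Fintype m] (S : Matrix m m ℝ) :
    ∃ C, ∀ x : m → ℝ, x ⬝ᵥ S *ᵥ x ≤ C * ‖x‖ ^ 2 := by
  refine ⟨∑ i, ∑ j, |S i j|, fun x => ?_⟩
  simp only [dotProduct, Matrix.mulVec, Finset.mul_sum, Finset.sum_mul]
  refine Finset.sum_le_sum fun i _ => Finset.sum_le_sum fun j _ => ?_
  calc x i * (S i j * x j) ≤ |x i * (S i j * x j)| := le_abs_self _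
    _ = |S i j| * (‖x i‖ * ‖x j‖) := by
        rw [abs_mul, abs_mul, Real.norm_eq_abs, Real.norm_eq_abs]
        ring
    _ ≤ |S i j| * ‖x‖ ^ 2 := by
        rw [sq]
        gcongr <;> exact norm_le_pi_norm x _

theorem dotProduct_mulVec_comm_of_transpose_eq {m : Type*} [Fintype m] {S : Matrix m m ℝ}
    (hS : Sᵀ = S) (a b : m → ℝ) : a ⬝ᵥ S *ᵥ b = b ⬝ᵥ S *ᵥ a := by
  rw [Matrix.dotProduct_mulVec, ← Matrix.mulVec_transpose, hS, dotProduct_comm]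

theorem dotProduct_transpose_mulVec {m k : Type*} [Fintype m] [Fintype k] (M : Matrix m k ℝ)
    (a : k → ℝ) (b : m → ℝ) : a ⬝ᵥ Mᵀ *ᵥ b = (M *ᵥ a) ⬝ᵥ b := by
  rw [Matrix.dotProduct_mulVec, Matrix.vecMul_transpose]

theorem continuousAt_matrix_mul {X k l m : Type*} [TopologicalSpace X] [Fintype l]
    {f : X → Matrix k l ℝ} {g : X → Matrix l m ℝ} {x : X} (hf : ContinuousAt f x)
    (hg : ContinuousAt g x) : ContinuousAt (fun y => f y * g y) x :=
  (continuous_fst.matrix_mul continuous_snd).continuousAt.comp (hf.prodMk hg)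

variable {n ι : Type*} [Fintype n] [Fintype ι] [DecidableEq ι]

/-- One step of the Riccati recursion. -/
noncomputable def riccatiMap (A : Matrix n n ℝ) (B : Matrix n ι ℝ) (Q : Matrix n n ℝ)
    (R : Matrix ι ι ℝ) (P : Matrix n n ℝ) : Matrix n n ℝ :=
  Aᵀ * P * A - (Bᵀ * P * A)ᵀ * (Bᵀ * P * B + R)⁻¹ * (Bᵀ * P * A) + Q

/-- The feedback that minimizes the one-step cost. -/
noncomputable def riccatiGain (A : Matrix n n ℝ) (B : Matrix n ι ℝ) (R : Matrix ι ι ℝ)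
    (P : Matrix n n ℝ) : Matrix ι n ℝ :=
  (Bᵀ * P * B + R)⁻¹ * (Bᵀ * P * A)

variable {A : Matrix n n ℝ} {B : Matrix n ι ℝ} {Q P P' : Matrix n n ℝ} {R : Matrix ι ι ℝ}

theorem isUnit_det_input_weight (hR : R.PosDef) (hP : P.PosSemidef) :
    IsUnit (Bᵀ * P * B + R).det :=
  (posDef_input_weight hR hP).det_pos.ne'.isUnit

theorem riccatiMap_isHermitian (hQ : Q.PosSemidef) (hR : R.PosDef) (hP : P.PosSemidef) :
    (riccatiMap A B Q R P).IsHermitian := by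
  have h1 := transpose_eq_of_isHermitian hP.1
  have h2 := transpose_eq_of_isHermitian hQ.1
  have h3 := transpose_eq_of_isHermitian (posDef_input_weight (B := B) hR hP).1
  rw [Matrix.IsHermitian, Matrix.conjTranspose_eq_transpose_of_trivial, riccatiMap]
  simp only [Matrix.transpose_add, Matrix.transpose_sub, Matrix.transpose_mul,
    Matrix.transpose_transpose, Matrix.transpose_nonsing_inv, h1, h2, Matrix.mul_assoc]
  simp only [Matrix.transpose_add, Matrix.transpose_mul, Matrix.transpose_transpose, h1,
    Matrix.mul_assoc] at h3
  rw [h3]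

/-- Completing the square in the one-step cost. -/
theorem one_step_cost_eq (hR : R.PosDef) (hP : P.PosSemidef) (x : n → ℝ) (u : ι → ℝ) :
    x ⬝ᵥ Q *ᵥ x + u ⬝ᵥ R *ᵥ u + (A *ᵥ x + B *ᵥ u) ⬝ᵥ P *ᵥ (A *ᵥ x + B *ᵥ u) =
      x ⬝ᵥ riccatiMap A B Q R P *ᵥ x +
        (u + riccatiGain A B R P *ᵥ x) ⬝ᵥ (Bᵀ * P * B + R) *ᵥ (u + riccatiGain A B R P *ᵥ x) := by
  have hPt := transpose_eq_of_isHermitian hP.1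
  set G := Bᵀ * P * B + R with hG
  set M := Bᵀ * P * A with hM
  have hGt : Gᵀ = G := transpose_eq_of_isHermitian (posDef_input_weight hR hP).1
  have hK : G *ᵥ (riccatiGain A B R P *ᵥ x) = M *ᵥ x := by
    rw [riccatiGain, ← hG, ← hM, Matrix.mulVec_mulVec, ← Matrix.mul_assoc,
      Matrix.mul_nonsing_inv _ (isUnit_det_input_weight hR hP), Matrix.one_mul]
  set w := riccatiGain A B R P *ᵥ x with hw
  have hwx : w ⬝ᵥ M *ᵥ x = x ⬝ᵥ (Mᵀ * G⁻¹ * M) *ᵥ x := by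
    have h1 : w = G⁻¹ *ᵥ (M *ᵥ x) := by
      rw [hw, riccatiGain, ← Matrix.mulVec_mulVec]
    rw [← Matrix.mulVec_mulVec x (Mᵀ * G⁻¹) M, ← Matrix.mulVec_mulVec _ Mᵀ,
      dotProduct_transpose_mulVec, ← h1,
      dotProduct_comm]
  have hGu : u ⬝ᵥ G *ᵥ u = (B *ᵥ u) ⬝ᵥ P *ᵥ (B *ᵥ u) + u ⬝ᵥ R *ᵥ u := by
    rw [hG, Matrix.add_mulVec, dotProduct_add, ← Matrix.mulVec_mulVec, ← Matrix.mulVec_mulVec,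
      Matrix.dotProduct_mulVec u, Matrix.vecMul_transpose]
  have hMu : u ⬝ᵥ M *ᵥ x = (B *ᵥ u) ⬝ᵥ P *ᵥ (A *ᵥ x) := by
    rw [hM, ← Matrix.mulVec_mulVec, ← Matrix.mulVec_mulVec,
      Matrix.dotProduct_mulVec u, Matrix.vecMul_transpose]
  have hA : x ⬝ᵥ (Aᵀ * P * A) *ᵥ x = (A *ᵥ x) ⬝ᵥ P *ᵥ (A *ᵥ x) := by
    rw [← Matrix.mulVec_mulVec, ← Matrix.mulVec_mulVec, Matrix.dotProduct_mulVec x,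
      Matrix.vecMul_transpose]
  have hT : riccatiMap A B Q R P = Aᵀ * P * A - Mᵀ * G⁻¹ * M + Q := rfl
  rw [hT, Matrix.add_mulVec, Matrix.sub_mulVec, dotProduct_add, dotProduct_sub, ← hwx, hA]
  simp only [Matrix.mulVec_add, dotProduct_add, add_dotProduct, hK, hGu, hMu]
  rw [dotProduct_mulVec_comm_of_transpose_eq hGt w u, hK, hMu,
    dotProduct_mulVec_comm_of_transpose_eq hPt (A *ᵥ x) (B *ᵥ u)]
  ring

theorem riccatiMap_le_one_step_cost (hR : R.PosDef) (hP : P.PosSemidef) (x : n → ℝ) (u : ι → ℝ) :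
    x ⬝ᵥ riccatiMap A B Q R P *ᵥ x ≤
      x ⬝ᵥ Q *ᵥ x + u ⬝ᵥ R *ᵥ u + (A *ᵥ x + B *ᵥ u) ⬝ᵥ P *ᵥ (A *ᵥ x + B *ᵥ u) := by
  rw [one_step_cost_eq hR hP]
  have := (posDef_input_weight (B := B) hR hP).posSemidef.dotProduct_mulVec_nonneg
    (u + riccatiGain A B R P *ᵥ x)
  simp only [star_trivial] at this
  linarith

theorem riccatiMap_eq_one_step_cost (hR : R.PosDef) (hP : P.PosSemidef) (x : n → ℝ) :
    ∃ u : ι → ℝ, x ⬝ᵥ riccatiMap A B Q R P *ᵥ x =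
      x ⬝ᵥ Q *ᵥ x + u ⬝ᵥ R *ᵥ u + (A *ᵥ x + B *ᵥ u) ⬝ᵥ P *ᵥ (A *ᵥ x + B *ᵥ u) := by
  refine ⟨-(riccatiGain A B R P *ᵥ x), ?_⟩
  rw [one_step_cost_eq hR hP]
  simp

theorem riccatiMap_posSemidef (hQ : Q.PosSemidef) (hR : R.PosDef) (hP : P.PosSemidef) :
    (riccatiMap A B Q R P).PosSemidef := by
  refine Matrix.PosSemidef.of_dotProduct_mulVec_nonneg (riccatiMap_isHermitian hQ hR hP)
    fun x => ?_
  obtain ⟨u, hu⟩ := riccatiMap_eq_one_step_cost (A := A) (B := B) (Q := Q) hR hP x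
  rw [star_trivial, hu]
  have := quadratic_nonneg hQ x
  have := quadratic_nonneg hR.posSemidef u
  have := quadratic_nonneg hP (A *ᵥ x + B *ᵥ u)
  positivity

/-- The quadratic form of `riccatiMap` is a minimum over `u` of costs increasing in `P`; the
minimizer for `P'` serves as a test input for `P`. -/
theorem riccatiMap_mono (hR : R.PosDef) (hP : P.PosSemidef) (hP' : P'.PosSemidef)
    (h : ∀ x, x ⬝ᵥ P *ᵥ x ≤ x ⬝ᵥ P' *ᵥ x) (x : n → ℝ) :
    x ⬝ᵥ riccatiMap A B Q R P *ᵥ x ≤ x ⬝ᵥ riccatiMap A B Q R P' *ᵥ x := by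
  obtain ⟨u, hu⟩ := riccatiMap_eq_one_step_cost (A := A) (B := B) (Q := Q) hR hP' x
  rw [hu]
  exact (riccatiMap_le_one_step_cost hR hP x u).trans (by gcongr; exact h _)

theorem continuousAt_riccatiMap (hR : R.PosDef) (hP : P.PosSemidef) :
    ContinuousAt (riccatiMap A B Q R) P := by
  have hinv : ContinuousAt (fun P : Matrix n n ℝ => (Bᵀ * P * B + R)⁻¹) P := by
    refine ContinuousAt.comp (g := fun M : Matrix ι ι ℝ => M⁻¹) (continuousAt_matrix_inv _ ?_)
      (Continuous.continuousAt (by fun_prop))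
    have h0 : (Bᵀ * P * B + R).det ≠ 0 := (posDef_input_weight hR hP).det_pos.ne'
    have : (Ring.inverse : ℝ → ℝ) = fun x => x⁻¹ := by
      ext x
      exact Ring.inverse_eq_inv x
    rw [this]
    exact continuousAt_inv₀ h0
  have h1 : ContinuousAt (fun P : Matrix n n ℝ => (Bᵀ * P * A)ᵀ) P :=
    Continuous.continuousAt (by fun_prop)
  have h2 : ContinuousAt (fun P : Matrix n n ℝ => Bᵀ * P * A) P :=
    Continuous.continuousAt (by fun_prop)
  have h3 : ContinuousAt (fun P : Matrix n n ℝ => Aᵀ * P * A) P :=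
    Continuous.continuousAt (by fun_prop)
  exact (h3.sub (continuousAt_matrix_mul (continuousAt_matrix_mul h1 hinv) h2)).add
    continuousAt_const

/-- The value matrices of the finite-horizon linear-quadratic problems. -/
noncomputable def riccatiIterate (A : Matrix n n ℝ) (B : Matrix n ι ℝ) (Q : Matrix n n ℝ)
    (R : Matrix ι ι ℝ) (k : ℕ) : Matrix n n ℝ :=
  (riccatiMap A B Q R)^[k] 0

theorem riccatiIterate_succ (k : ℕ) :
    riccatiIterate A B Q R (k + 1) = riccatiMap A B Q R (riccatiIterate A B Q R k) :=
  Function.iterate_succ_apply' _ _ _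

theorem riccatiIterate_posSemidef (hQ : Q.PosSemidef) (hR : R.PosDef) (k : ℕ) :
    (riccatiIterate A B Q R k).PosSemidef := by
  induction k with
  | zero => exact Matrix.PosSemidef.zero
  | succ k ih =>
    rw [riccatiIterate_succ]
    exact riccatiMap_posSemidef hQ hR ih

theorem monotone_riccatiIterate (hQ : Q.PosSemidef) (hR : R.PosDef) (x : n → ℝ) :
    Monotone fun k => x ⬝ᵥ riccatiIterate A B Q R k *ᵥ x := by
  suffices h : ∀ k x, x ⬝ᵥ riccatiIterate A B Q R k *ᵥ x
      ≤ x ⬝ᵥ riccatiIterate A B Q R (k + 1) *ᵥ x from monotone_nat_of_le_succ fun k => h k x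
  intro k
  induction k with
  | zero =>
    intro x
    have := quadratic_nonneg (riccatiIterate_posSemidef (A := A) (B := B) hQ hR 1) x
    simpa [riccatiIterate] using this
  | succ k ih =>
    intro x
    rw [riccatiIterate_succ, riccatiIterate_succ (k + 1)]
    exact riccatiMap_mono hR (riccatiIterate_posSemidef hQ hR k)
      (riccatiIterate_posSemidef hQ hR (k + 1)) ih x

/-- Dynamic programming: the finite-horizon value is at most the cost of any admissible trajectory.
The free start time `i` makes the induction go through. -/
theorem riccatiIterate_le_sum_cost (hQ : Q.PosSemidef) (hR : R.PosDef) (z : ℕ → n → ℝ)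
    (u : ℕ → ι → ℝ) (hz : ∀ k, z (k + 1) = A *ᵥ z k + B *ᵥ u k) (N i : ℕ) :
    z i ⬝ᵥ riccatiIterate A B Q R N *ᵥ z i ≤
      ∑ k ∈ Finset.range N, (z (i + k) ⬝ᵥ Q *ᵥ z (i + k) + u (i + k) ⬝ᵥ R *ᵥ u (i + k)) := by
  induction N generalizing i with
  | zero => simp [riccatiIterate]
  | succ N ih =>
    rw [riccatiIterate_succ, Finset.sum_range_succ']
    refine (riccatiMap_le_one_step_cost hR (riccatiIterate_posSemidef hQ hR N) (z i) (u i)).trans ?_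
    rw [← hz i, add_comm]
    refine add_le_add ((ih (i + 1)).trans_eq (Finset.sum_congr rfl fun k _ => ?_)) (by simp)
    rw [show i + 1 + k = i + (k + 1) by ring]

theorem bddAbove_riccatiIterate (hQ : Q.PosSemidef) (hR : R.PosDef)
    (H : ∀ (c : ℂ) (a : (n → ℝ) →ₗ[ℝ] ℂ), 1 ≤ ‖c‖ → (∀ x, a (A *ᵥ x) = c * a x) →
      (∀ u, a (B *ᵥ u) = 0) → a = 0) (x : n → ℝ) :
    BddAbove (Set.range fun k => x ⬝ᵥ riccatiIterate A B Q R k *ᵥ x) := by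
  obtain ⟨z, u, rfl, hz, hzs, hus⟩ := exists_summable_trajectory A B H x
  obtain ⟨CQ, hCQ⟩ := exists_quadratic_le Q
  obtain ⟨CR, hCR⟩ := exists_quadratic_le R
  have hs := (hzs.mul_left CQ).add (hus.mul_left CR)
  have hle (k : ℕ) : z k ⬝ᵥ Q *ᵥ z k + u k ⬝ᵥ R *ᵥ u k ≤ CQ * ‖z k‖ ^ 2 + CR * ‖u k‖ ^ 2 :=
    add_le_add (hCQ _) (hCR _)
  have hpos (k : ℕ) : 0 ≤ z k ⬝ᵥ Q *ᵥ z k + u k ⬝ᵥ R *ᵥ u k :=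
    add_nonneg (quadratic_nonneg hQ _) (quadratic_nonneg hR.posSemidef _)
  refine ⟨∑' k, (CQ * ‖z k‖ ^ 2 + CR * ‖u k‖ ^ 2), ?_⟩
  rintro _ ⟨N, rfl⟩
  have h := riccatiIterate_le_sum_cost hQ hR z u hz N 0
  simp only [zero_add] at h
  exact h.trans ((Finset.sum_le_sum fun k _ => hle k).trans
    (hs.sum_le_tsum _ fun k _ => (hpos k).trans (hle k)))

/-- A sequence of symmetric matrices whose quadratic forms are monotone and bounded converges. -/
theorem exists_tendsto_of_monotone_quadratic {n : Type*} [Fintype n]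
    (S : ℕ → Matrix n n ℝ) (hS : ∀ k, (S k).IsHermitian)
    (hmono : ∀ x : n → ℝ, Monotone fun k => x ⬝ᵥ S k *ᵥ x)
    (hbdd : ∀ x : n → ℝ, BddAbove (Set.range fun k => x ⬝ᵥ S k *ᵥ x)) :
    ∃ T, Tendsto S atTop (𝓝 T) := by
  classical
  have hq (x : n → ℝ) : ∃ l, Tendsto (fun k => x ⬝ᵥ S k *ᵥ x) atTop (𝓝 l) :=
    ⟨_, tendsto_atTop_ciSup (hmono x) (hbdd x)⟩
  choose q hq using hq
  -- Polarization recovers the entries from quadratic forms, so convergence of the forms suffices.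
  have hpol (i j : n) (k : ℕ) : S k i j =
      ((Pi.single i 1 + Pi.single j 1) ⬝ᵥ S k *ᵥ (Pi.single i 1 + Pi.single j 1)
        - Pi.single i 1 ⬝ᵥ S k *ᵥ Pi.single i 1 - Pi.single j 1 ⬝ᵥ S k *ᵥ Pi.single j 1) / 2 := by
    have hsymm : S k j i = S k i j := by
      have := congrFun (congrFun (transpose_eq_of_isHermitian (hS k)) i) j
      simpa using this
    simp only [Matrix.mulVec_add, dotProduct_add, add_dotProduct, Matrix.mulVec_single_one,
      single_one_dotProduct, Matrix.col_apply, hsymm]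
    ring
  refine ⟨fun i j => (q (Pi.single i 1 + Pi.single j 1) - q (Pi.single i 1) - q (Pi.single j 1)) / 2,
    tendsto_pi_nhds.2 fun i => tendsto_pi_nhds.2 fun j => ?_⟩
  simp_rw [hpol i j]
  exact (((hq _).sub (hq _)).sub (hq _)).div_const 2

/-- Existence of a positive definite solution of the discrete algebraic Riccati equation for
stabilizable input and observable state weight. -/
theorem exists_posDef_riccatiMap_eq [DecidableEq n] (hQ : Q.PosSemidef) (hR : R.PosDef)
    (H : ∀ (c : ℂ) (a : (n → ℝ) →ₗ[ℝ] ℂ), 1 ≤ ‖c‖ → (∀ x, a (A *ᵥ x) = c * a x) →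
      (∀ u, a (B *ᵥ u) = 0) → a = 0)
    (hobs : ∀ x : n → ℝ, (∀ k : ℕ, (A ^ k *ᵥ x) ⬝ᵥ Q *ᵥ (A ^ k *ᵥ x) = 0) → x = 0) :
    ∃ P, P.PosDef ∧ P = riccatiMap A B Q R P := by
  obtain ⟨P, hlim⟩ := exists_tendsto_of_monotone_quadratic (riccatiIterate A B Q R)
    (fun k => (riccatiIterate_posSemidef hQ hR k).1) (monotone_riccatiIterate hQ hR)
    (bddAbove_riccatiIterate hQ hR H)
  have hPherm : P.IsHermitian := by
    have h1 : Tendsto (fun k => (riccatiIterate A B Q R k)ᵀ) atTop (𝓝 Pᵀ) :=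
      (Continuous.tendsto (by fun_prop) P).comp hlim
    rw [Matrix.IsHermitian, Matrix.conjTranspose_eq_transpose_of_trivial]
    refine tendsto_nhds_unique h1 (hlim.congr fun k => ?_)
    rw [transpose_eq_of_isHermitian (riccatiIterate_posSemidef hQ hR k).1]
  have hPpos : P.PosSemidef := by
    refine Matrix.PosSemidef.of_dotProduct_mulVec_nonneg hPherm fun x => ?_
    rw [star_trivial]
    have h1 : Tendsto (fun k => x ⬝ᵥ riccatiIterate A B Q R k *ᵥ x) atTop (𝓝 (x ⬝ᵥ P *ᵥ x)) := by
      have hc : Continuous fun S : Matrix n n ℝ => x ⬝ᵥ S *ᵥ x :=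
        continuous_const.dotProduct (continuous_id.matrix_mulVec continuous_const)
      exact (hc.tendsto P).comp hlim
    exact ge_of_tendsto' h1 fun k => quadratic_nonneg (riccatiIterate_posSemidef hQ hR k) x
  have hfix : P = riccatiMap A B Q R P := by
    have h1 := (continuousAt_riccatiMap (A := A) (B := B) (Q := Q) hR hPpos).tendsto.comp hlim
    refine tendsto_nhds_unique ((tendsto_add_atTop_iff_nat 1).2 hlim) (h1.congr fun k => ?_)
    rw [riccatiIterate_succ]
    rfl
  refine ⟨P, Matrix.PosDef.of_dotProduct_mulVec_pos hPherm fun {x} hx => ?_, hfix⟩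
  rw [star_trivial]
  refine lt_of_le_of_ne (quadratic_nonneg hPpos x) fun h0 => hx ?_
  -- Zero value makes every term of the optimal cost vanish; `R > 0` then forces zero input, so the
  -- null set of `P` is `A`-invariant and lies in that of `Q`.
  have step (y : n → ℝ) (hy : y ⬝ᵥ P *ᵥ y = 0) :
      y ⬝ᵥ Q *ᵥ y = 0 ∧ (A *ᵥ y) ⬝ᵥ P *ᵥ (A *ᵥ y) = 0 := by
    obtain ⟨u, hu⟩ := riccatiMap_eq_one_step_cost (A := A) (B := B) (Q := Q) hR hPpos y
    rw [← hfix, hy] at hu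
    have h1 := quadratic_nonneg hQ y
    have h2 := quadratic_nonneg hR.posSemidef u
    have h3 := quadratic_nonneg hPpos (A *ᵥ y + B *ᵥ u)
    have hu0 : u = 0 := by
      by_contra hne
      have := hR.dotProduct_mulVec_pos hne
      rw [star_trivial] at this
      linarith
    subst hu0
    simp only [Matrix.mulVec_zero, add_zero, dotProduct_zero] at hu h3
    constructor <;> linarith
  have hall (k : ℕ) : (A ^ k *ᵥ x) ⬝ᵥ P *ᵥ (A ^ k *ᵥ x) = 0 := by
    induction k with
    | zero => simpa using h0.symm
    | succ k ih =>
      rw [pow_succ', ← Matrix.mulVec_mulVec]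
      exact (step _ ih).2
  exact hobs x fun k => (step _ (hall k)).1

end AlgebraicRiccati

/-! ### Growth of the closed loop when packets are lost. -/

section ClosedLoop

variable {n m nW nP : ℕ} {Ω : Type}

/-- The remote estimate cannot distinguish outcomes for which all packets were lost. -/
theorem stronglyMeasurable_sigmaW_eq_of_loss {β : ℕ → Ω → ℝ}
    {x : ℕ → Ω → EuclideanSpace ℝ (Fin n)} {k : ℕ} {f : Ω → EuclideanSpace ℝ (Fin n)}
    (hf : StronglyMeasurable[sigmaW β x k] f) {ω ω' : Ω} (hω : ∀ j ≤ k, β j ω = 0)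
    (hω' : ∀ j ≤ k, β j ω' = 0) : f ω = f ω' := by
  -- The sets that do not separate `ω` from `ω'` form a σ-algebra; it contains `sigmaW` because each
  -- observation is `0` at both outcomes.
  let 𝓐 : MeasurableSpace Ω :=
    { MeasurableSet' := fun s => ω ∈ s ↔ ω' ∈ s
      measurableSet_empty := by simp
      measurableSet_compl := fun s hs => not_congr hs
      measurableSet_iUnion := fun s hs => by simp only [Set.mem_iUnion, hs] }
  have hle : sigmaW β x k ≤ 𝓐 := by
    refine iSup₂_le fun j hj => ?_
    rintro _ ⟨t, -, rfl⟩
    change yW β x j ω ∈ t ↔ yW β x j ω' ∈ t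
    simp [yW, hω j hj, hω' j hj]
  have h : MeasurableSet[𝓐] (f ⁻¹' {f ω}) :=
    (hf.measurable.mono hle le_rfl) (measurableSet_singleton _)
  exact (h.1 rfl).symm

variable {A : Matrix (Fin n) (Fin n) ℝ} {BW : Matrix (Fin n) (Fin nW) ℝ}
  {BP : Matrix (Fin n) (Fin nP) ℝ} {H : Matrix (Fin m) (Fin n) ℝ}
  {LW : Matrix (Fin nW ⊕ Fin nP) (Fin n) ℝ} {LP : Matrix (Fin nP) (Fin n) ℝ}
  {Qv : Matrix (Fin m) (Fin m) ℝ} {p : ℝ}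

/-- The embedded input is invisible to `a`, and the remote input is frozen on the loss event, so it
only contributes to an offset independent of `ω`. Only `j < k` matters, since `x k` uses estimates
up to time `k - 1`. -/
theorem exists_forall_loss_apply_eq [MeasurableSpace Ω] {P : Measure Ω}
    {x0 : Ω → EuclideanSpace ℝ (Fin n)} {v : ℕ → Ω → EuclideanSpace ℝ (Fin m)}
    {β : ℕ → Ω → ℝ} {x : ℕ → Ω → EuclideanSpace ℝ (Fin n)}
    (hx : IsClosedLoop P A BW BP H LW LP x0 v β x) (a : EuclideanSpace ℝ (Fin n) →L[ℝ] ℂ) (c : ℂ)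
    (hA : ∀ y, a (Matrix.toEuclideanLin A y) = c * a y)
    (hB : ∀ u, a (Matrix.toEuclideanLin BP u) = 0) (k : ℕ) :
    ∃ d, ∀ ω, (∀ j < k, β j ω = 0) → a (x k ω) = c ^ k * a (x0 ω) + d := by
  induction k with
  | zero => exact ⟨0, fun ω _ => by simp [hx.init]⟩
  | succ k ih =>
    obtain ⟨d, hd⟩ := ih
    by_cases hne : ∃ ω₀, ∀ j < k + 1, β j ω₀ = 0
    · obtain ⟨ω₀, hω₀⟩ := hne
      refine ⟨c * d + a (Matrix.toEuclideanLin (combinedB BW BP)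
        (Matrix.toEuclideanLin LW (estW P β x k ω₀))), fun ω hω => ?_⟩
      have hest : estW P β x k ω = estW P β x k ω₀ :=
        stronglyMeasurable_sigmaW_eq_of_loss stronglyMeasurable_condExp
          (fun j hj => hω j (Nat.lt_succ_of_le hj)) (fun j hj => hω₀ j (Nat.lt_succ_of_le hj))
      rw [hx.step, map_add, map_add, hA, hB, hest, hd ω fun j hj => hω j (hj.trans k.lt_succ_self)]
      ring
    · exact ⟨0, fun ω hω => (hne ⟨ω, hω⟩).elim⟩

theorem apply_eq_of_annihilates_input [MeasurableSpace Ω] {P : Measure Ω}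
    {x0 : Ω → EuclideanSpace ℝ (Fin n)} {v : ℕ → Ω → EuclideanSpace ℝ (Fin m)}
    {β : ℕ → Ω → ℝ} {x : ℕ → Ω → EuclideanSpace ℝ (Fin n)}
    (hx : IsClosedLoop P A BW BP H LW LP x0 v β x) (a : EuclideanSpace ℝ (Fin n) →L[ℝ] ℂ) (c : ℂ)
    (hA : ∀ y, a (Matrix.toEuclideanLin A y) = c * a y)
    (hB : ∀ u, a (Matrix.toEuclideanLin (combinedB BW BP) u) = 0)
    (hBP : ∀ u, a (Matrix.toEuclideanLin BP u) = 0) (k : ℕ) (ω : Ω) :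
    a (x k ω) = c ^ k * a (x0 ω) := by
  induction k with
  | zero => simp [hx.init]
  | succ k ih =>
    rw [hx.step, map_add, map_add, hA, hB, hBP, ih]
    ring

/-- A real functional has variance equal to its squared norm under the standard Gaussian; apply this
to the real and imaginary parts of `a`. -/
theorem lintegral_sq_enorm_ne_zero (a : EuclideanSpace ℝ (Fin n) →L[ℝ] ℂ) (ha : a ≠ 0) :
    ∫⁻ y, ‖a y‖ₑ ^ 2 ∂stdGaussian (EuclideanSpace ℝ (Fin n)) ≠ 0 := by
  intro h
  rw [lintegral_eq_zero_iff (by fun_prop)] at h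
  have key (L : ℂ →L[ℝ] ℝ) : L ∘L a = 0 := by
    have h0 : (L ∘L a : EuclideanSpace ℝ (Fin n) → ℝ) =ᵐ[stdGaussian _] fun _ => 0 := by
      filter_upwards [h] with y hy
      have : a y = 0 := by simpa using hy
      simp [this]
    have h1 := variance_dual_stdGaussian (L ∘L a)
    rw [variance_congr h0] at h1
    have h2 : ‖L ∘L a‖ ^ 2 = 0 := by
      rw [← h1]
      exact variance_zero _
    exact norm_eq_zero.1 (pow_eq_zero_iff two_ne_zero |>.1 h2)
  refine ha (ContinuousLinearMap.ext fun y => Complex.ext ?_ ?_)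
  · exact DFunLike.congr_fun (key Complex.reCLM) y
  · exact DFunLike.congr_fun (key Complex.imCLM) y

theorem two_mul_sq_enorm_le (w d : ℂ) : 2 * ‖w‖ₑ ^ 2 ≤ ‖w + d‖ₑ ^ 2 + ‖-w + d‖ₑ ^ 2 := by
  simp only [enorm_eq_nnnorm]
  norm_cast
  rw [← NNReal.coe_le_coe]
  push_cast
  have h := parallelogram_law_with_norm ℝ d w
  rw [add_comm d w, show d - w = -w + d by ring] at h
  nlinarith [sq_nonneg ‖d‖]

/-- Averaging over `y` and `-y`, which have the same law, removes the cross term with `d`. -/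
theorem mul_lintegral_le_lintegral_add_const (a : EuclideanSpace ℝ (Fin n) →L[ℝ] ℂ) (c d : ℂ) :
    ‖c‖ₑ ^ 2 * ∫⁻ y, ‖a y‖ₑ ^ 2 ∂stdGaussian (EuclideanSpace ℝ (Fin n)) ≤
      ∫⁻ y, ‖c * a y + d‖ₑ ^ 2 ∂stdGaussian (EuclideanSpace ℝ (Fin n)) := by
  set γ := stdGaussian (EuclideanSpace ℝ (Fin n)) with hγ
  have hneg : ∫⁻ y, ‖-(c * a y) + d‖ₑ ^ 2 ∂γ = ∫⁻ y, ‖c * a y + d‖ₑ ^ 2 ∂γ := by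
    have hmap : γ.map (LinearIsometryEquiv.neg ℝ) = γ := stdGaussian_map _
    conv_rhs => rw [← hmap]
    rw [lintegral_map (by fun_prop) (by fun_prop)]
    simp
  have h2 : 2 * (‖c‖ₑ ^ 2 * ∫⁻ y, ‖a y‖ₑ ^ 2 ∂γ) ≤ 2 * ∫⁻ y, ‖c * a y + d‖ₑ ^ 2 ∂γ := by
    rw [← lintegral_const_mul _ (by fun_prop), ← lintegral_const_mul _ (by fun_prop), two_mul]
    nth_rw 2 [← hneg]
    rw [← lintegral_add_left (by fun_prop)]
    refine lintegral_mono fun y => ?_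
    have := two_mul_sq_enorm_le (c * a y) d
    rwa [enorm_mul, mul_pow] at this
  rwa [ENNReal.mul_le_mul_iff_right (by simp) (by simp)] at h2

theorem lintegral_le_of_annihilates [MeasurableSpace Ω] {P : Measure Ω} [IsProbabilityMeasure P]
    (hp0 : 0 ≤ p)
    {x0 : Ω → EuclideanSpace ℝ (Fin n)} {v : ℕ → Ω → EuclideanSpace ℝ (Fin m)}
    {β : ℕ → Ω → ℝ} {x : ℕ → Ω → EuclideanSpace ℝ (Fin n)}
    (hdata : IsRandomData P 0 1 Qv p x0 v β)
    (a : EuclideanSpace ℝ (Fin n) →L[ℝ] ℂ) (c d : ℂ) (hc : 1 ≤ p * ‖c‖ ^ 2) (k : ℕ)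
    (hax : ∀ ω, (∀ j < k, β j ω = 0) → a (x k ω) = c ^ k * a (x0 ω) + d) :
    ∫⁻ y, ‖a y‖ₑ ^ 2 ∂stdGaussian (EuclideanSpace ℝ (Fin n)) ≤
      ‖a‖ₑ ^ 2 * ∫⁻ ω, ‖x k ω‖ₑ ^ 2 ∂P := by
  set γ := stdGaussian (EuclideanSpace ℝ (Fin n)) with hγ
  set N : Set Ω := ⋂ j ∈ Finset.range k, β j ⁻¹' {0} with hN
  have hNm : MeasurableSet N :=
    Finset.measurableSet_biInter _ fun j _ => hdata.measurable_β j (measurableSet_singleton 0)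
  have hNmem (ω : Ω) : ω ∈ N ↔ ∀ j < k, β j ω = 0 := by simp [hN]
  have hPN : P N = ENNReal.ofReal p ^ k := by
    rw [hN, hdata.indep_β.measure_inter_preimage_eq_mul _
      (fun j _ => measurableSet_singleton (0 : ℝ))]
    refine (Finset.prod_congr rfl fun j _ => hdata.prob_loss j).trans ?_
    simp
  set F : EuclideanSpace ℝ (Fin n) → ENNReal := fun y => ‖c ^ k * a y + d‖ₑ ^ 2 with hF
  have hFm : Measurable F := by fun_prop
  -- The loss event `N` as an event of the pair `(v, β)`, which is what `x0` is independent of.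
  set T : Set ((ℕ → EuclideanSpace ℝ (Fin m)) × (ℕ → ℝ)) :=
    {s | ∀ j < k, s.2 j = 0} with hT
  have hTm : MeasurableSet T := by
    have : T = ⋂ j ∈ Finset.range k, (fun s => s.2 j) ⁻¹' {0} := by
      ext s
      simp [hT]
    rw [this]
    exact Finset.measurableSet_biInter _ fun j _ =>
      (by fun_prop : Measurable fun s : (ℕ → EuclideanSpace ℝ (Fin m)) × (ℕ → ℝ) => s.2 j)
        (measurableSet_singleton 0)
  have hlaw : ∫⁻ ω, F (x0 ω) ∂P = ∫⁻ y, F y ∂γ := by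
    rw [hdata.law_x0.lintegral_comp hFm.aemeasurable, multivariateGaussian_zero_one]
  have hind : ∫⁻ ω in N, F (x0 ω) ∂P = (∫⁻ y, F y ∂γ) * P N := by
    have hi := hdata.indep_x0.comp hFm
      (measurable_const.indicator hTm : Measurable (T.indicator fun _ => (1 : ENNReal)))
    have h := lintegral_mul_eq_lintegral_mul_lintegral_of_indepFun
      (hFm.comp hdata.measurable_x0)
      ((measurable_const.indicator hTm).comp (by
        have := hdata.measurable_v
        have := hdata.measurable_β
        fun_prop)) hi
    have hTN (ω : Ω) : (T.indicator fun _ => (1 : ENNReal)) (fun k => v k ω, fun k => β k ω)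
        = N.indicator (fun _ => 1) ω := by
      by_cases hω : ω ∈ N
      · rw [Set.indicator_of_mem hω, Set.indicator_of_mem]
        exact (hNmem ω).1 hω
      · rw [Set.indicator_of_notMem hω, Set.indicator_of_notMem]
        exact fun h => hω ((hNmem ω).2 h)
    simp only [Pi.mul_apply, Function.comp_apply, hTN] at h
    rw [lintegral_indicator_const hNm, one_mul, hlaw] at h
    rw [← h, ← lintegral_indicator hNm]
    congr 1 with ω
    by_cases hω : ω ∈ N <;> simp [hω]
  have hone : 1 ≤ ‖c ^ k‖ₑ ^ 2 * P N := by
    have h1 : ‖c ^ k‖ₑ ^ 2 * P N = ENNReal.ofReal (p * ‖c‖ ^ 2) ^ k := by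
      rw [hPN, ENNReal.ofReal_mul hp0, ENNReal.ofReal_pow (norm_nonneg c), ofReal_norm, enorm_pow,
        mul_pow, ← pow_mul, ← pow_mul, mul_comm 2 k, mul_comm]
    rw [h1]
    exact one_le_pow₀ (by simpa using hc)
  calc ∫⁻ y, ‖a y‖ₑ ^ 2 ∂γ ≤ (‖c ^ k‖ₑ ^ 2 * P N) * ∫⁻ y, ‖a y‖ₑ ^ 2 ∂γ :=
        le_mul_of_one_le_left zero_le hone
    _ = (‖c ^ k‖ₑ ^ 2 * ∫⁻ y, ‖a y‖ₑ ^ 2 ∂γ) * P N := by ring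
    _ ≤ (∫⁻ y, F y ∂γ) * P N := by
        gcongr
        exact mul_lintegral_le_lintegral_add_const a (c ^ k) d
    _ = ∫⁻ ω in N, F (x0 ω) ∂P := hind.symm
    _ ≤ ∫⁻ ω in N, ‖a‖ₑ ^ 2 * ‖x k ω‖ₑ ^ 2 ∂P := by
        refine setLIntegral_mono' hNm fun ω hω => ?_
        rw [hF]
        simp only
        rw [← hax ω ((hNmem ω).1 hω), ← mul_pow]
        gcongr
        exact a.le_opENorm _
    _ ≤ ∫⁻ ω, ‖a‖ₑ ^ 2 * ‖x k ω‖ₑ ^ 2 ∂P := setLIntegral_le_lintegral _ _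
    _ = _ := lintegral_const_mul' _ _ (by simp)

end ClosedLoop

/-! ### Existence of the random data and of the closed loop. -/

section Existence

variable {n m nW nP : ℕ}

theorem iIndepFun_comp_measurePreserving {α Ω ι : Type*} {E : ι → Type*} [MeasurableSpace α]
    [MeasurableSpace Ω] [∀ i, MeasurableSpace (E i)] {μ : Measure α} {ν : Measure Ω}
    {f : ∀ i, Ω → E i} (h : iIndepFun f ν) {T : α → Ω} (hT : MeasurePreserving T μ ν)
    (hf : ∀ i, Measurable (f i)) : iIndepFun (fun i a => f i (T a)) μ := by
  rw [iIndepFun_iff_measure_inter_preimage_eq_mul] at h ⊢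
  intro S s hs
  have h1 : (⋂ i ∈ S, (fun a => f i (T a)) ⁻¹' s i) = T ⁻¹' ⋂ i ∈ S, f i ⁻¹' s i := by
    simp only [Set.preimage_iInter]
    rfl
  rw [h1, hT.measure_preimage
    (Finset.measurableSet_biInter _ fun i hi => hf i (hs i hi)).nullMeasurableSet, h S hs]
  exact Finset.prod_congr rfl fun i hi =>
    (hT.measure_preimage (hf i (hs i hi)).nullMeasurableSet).symm

theorem indepFun_comp_measurePreserving {α Ω E F : Type*} [MeasurableSpace α]
    [MeasurableSpace Ω] [MeasurableSpace E] [MeasurableSpace F] {μ : Measure α} {ν : Measure Ω}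
    {f : Ω → E} {g : Ω → F} (h : IndepFun f g ν) {T : α → Ω} (hT : MeasurePreserving T μ ν)
    (hf : Measurable f) (hg : Measurable g) :
    IndepFun (fun a => f (T a)) (fun a => g (T a)) μ := by
  rw [indepFun_iff_measure_inter_preimage_eq_mul] at h ⊢
  intro s t hs ht
  have h1 := hT.measure_preimage ((hf hs).inter (hg ht)).nullMeasurableSet
  have h2 := hT.measure_preimage (hf hs).nullMeasurableSet
  have h3 := hT.measure_preimage (hg ht).nullMeasurableSet
  rw [h s t hs ht, ← h2, ← h3] at h1
  exact h1

/-- Mean-square stabilizability is a statement about all realizations, so one must be exhibited to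
draw a conclusion from it. -/
theorem exists_isRandomData (μ : EuclideanSpace ℝ (Fin n)) (σ : Matrix (Fin n) (Fin n) ℝ)
    (Qv : Matrix (Fin m) (Fin m) ℝ) {p : ℝ} (hp0 : 0 ≤ p) (hp1 : p ≤ 1) :
    ∃ (Ω : Type) (_ : MeasurableSpace Ω) (P : Measure Ω) (_ : IsProbabilityMeasure P)
      (x0 : Ω → EuclideanSpace ℝ (Fin n)) (v : ℕ → Ω → EuclideanSpace ℝ (Fin m))
      (β : ℕ → Ω → ℝ), IsRandomData P μ σ Qv p x0 v β := by
  -- `true` encodes a loss; building `β` from bits makes it `0` or `1` at every outcome, not just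
  -- almost surely.
  let loss : Measure Bool :=
    ENNReal.ofReal p • Measure.dirac true + ENNReal.ofReal (1 - p) • Measure.dirac false
  have : IsProbabilityMeasure loss := ⟨by
    simp only [loss, Measure.add_apply, Measure.smul_apply, measure_univ, smul_eq_mul, mul_one]
    rw [← ENNReal.ofReal_add hp0 (by linarith)]
    simp⟩
  let PV : Measure (ℕ → EuclideanSpace ℝ (Fin m)) :=
    Measure.infinitePi fun _ => multivariateGaussian 0 Qv
  let PB : Measure (ℕ → Bool) := Measure.infinitePi fun _ => loss
  let g : Bool → ℝ := fun b => if b then 0 else 1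
  have hg : Measurable g := measurable_from_top
  have hsnd : MeasurePreserving (Prod.snd : EuclideanSpace ℝ (Fin n) ×
      ((ℕ → EuclideanSpace ℝ (Fin m)) × (ℕ → Bool)) → _)
      ((multivariateGaussian μ σ).prod (PV.prod PB)) (PV.prod PB) := measurePreserving_snd
  have hV : MeasurePreserving (fun ω : EuclideanSpace ℝ (Fin n) ×
      ((ℕ → EuclideanSpace ℝ (Fin m)) × (ℕ → Bool)) => ω.2.1)
      ((multivariateGaussian μ σ).prod (PV.prod PB)) PV := measurePreserving_fst.comp hsnd
  have hB : MeasurePreserving (fun ω : EuclideanSpace ℝ (Fin n) ×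
      ((ℕ → EuclideanSpace ℝ (Fin m)) × (ℕ → Bool)) => ω.2.2)
      ((multivariateGaussian μ σ).prod (PV.prod PB)) PB := measurePreserving_snd.comp hsnd
  have hBk (k : ℕ) : MeasurePreserving (fun ω : EuclideanSpace ℝ (Fin n) ×
      ((ℕ → EuclideanSpace ℝ (Fin m)) × (ℕ → Bool)) => ω.2.2 k)
      ((multivariateGaussian μ σ).prod (PV.prod PB)) loss :=
    (measurePreserving_eval_infinitePi _ k).comp hB
  refine ⟨EuclideanSpace ℝ (Fin n) × ((ℕ → EuclideanSpace ℝ (Fin m)) × (ℕ → Bool)), inferInstance,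
    (multivariateGaussian μ σ).prod (PV.prod PB), inferInstance, fun ω => ω.1,
    fun k ω => ω.2.1 k, fun k ω => g (ω.2.2 k), ?_⟩
  constructor
  · fun_prop
  · fun_prop
  · fun_prop
  · exact measurePreserving_fst.hasLaw
  · exact fun k => ((measurePreserving_eval_infinitePi _ k).comp hV).hasLaw
  · intro k ω
    cases ω.2.2 k <;> simp [g]
  · intro k
    have h := (hBk k).measure_preimage (s := {true}) (by simp)
    have he : {ω : EuclideanSpace ℝ (Fin n) × ((ℕ → EuclideanSpace ℝ (Fin m)) × (ℕ → Bool)) |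
        g (ω.2.2 k) = 0} = (fun ω => ω.2.2 k) ⁻¹' {true} := by
      ext ω
      cases h : ω.2.2 k <;> simp [g, h]
    rw [he, h]
    simp [loss]
  · intro k
    have h := (hBk k).measure_preimage (s := {false}) (by simp)
    have he : {ω : EuclideanSpace ℝ (Fin n) × ((ℕ → EuclideanSpace ℝ (Fin m)) × (ℕ → Bool)) |
        g (ω.2.2 k) = 1} = (fun ω => ω.2.2 k) ⁻¹' {false} := by
      ext ω
      cases h : ω.2.2 k <;> simp [g, h]
    rw [he, h]
    simp [loss]
  · have h := iIndepFun_infinitePi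
      (P := fun _ : ℕ => multivariateGaussian (0 : EuclideanSpace ℝ (Fin m)) Qv)
      (X := fun _ y => y) (by fun_prop)
    exact iIndepFun_comp_measurePreserving h hV (by fun_prop)
  · have h := iIndepFun_infinitePi (P := fun _ : ℕ => loss) (X := fun _ => g) (fun _ => hg)
    exact iIndepFun_comp_measurePreserving h hB (by fun_prop)
  · have h := indepFun_prod (μ := PV) (ν := PB) (X := fun y => y)
      (Y := fun (s : ℕ → Bool) (k : ℕ) => g (s k)) measurable_id (by fun_prop)
    exact indepFun_comp_measurePreserving h hsnd measurable_fst (by fun_prop)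
  · exact indepFun_prod (μ := multivariateGaussian μ σ) (ν := PV.prod PB) (X := fun y => y)
      (Y := fun (s : (ℕ → EuclideanSpace ℝ (Fin m)) × (ℕ → Bool)) =>
        ((fun k => s.1 k), fun k => g (s.2 k))) measurable_id (by fun_prop)

theorem sigmaW_congr {Ω : Type} {β : ℕ → Ω → ℝ} {x x' : ℕ → Ω → EuclideanSpace ℝ (Fin n)} {k : ℕ}
    (h : ∀ j ≤ k, x j = x' j) : sigmaW β x k = sigmaW β x' k := by
  refine iSup_congr fun j => iSup_congr fun hj => ?_
  have : yW β x j = yW β x' j := by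
    ext1 ω
    simp only [yW, h j hj]
  rw [this]

theorem sigmaP_congr {Ω : Type} {H : Matrix (Fin m) (Fin n) ℝ}
    {v : ℕ → Ω → EuclideanSpace ℝ (Fin m)} {β : ℕ → Ω → ℝ}
    {x x' : ℕ → Ω → EuclideanSpace ℝ (Fin n)} {k : ℕ}
    (h : ∀ j ≤ k, x j = x' j) : sigmaP H v β x k = sigmaP H v β x' k := by
  have h2 : (⨆ j ≤ k, MeasurableSpace.comap (yP H v x j) inferInstance)
      = ⨆ j ≤ k, MeasurableSpace.comap (yP H v x' j) inferInstance := by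
    refine iSup_congr fun j => iSup_congr fun hj => ?_
    have : yP H v x j = yP H v x' j := by
      ext1 ω
      simp only [yP, h j hj]
    rw [this]
  rw [sigmaP, sigmaP, sigmaW_congr h, h2]

theorem exists_isClosedLoop {Ω : Type} [MeasurableSpace Ω] (P : Measure Ω)
    (A : Matrix (Fin n) (Fin n) ℝ) (BW : Matrix (Fin n) (Fin nW) ℝ) (BP : Matrix (Fin n) (Fin nP) ℝ)
    (H : Matrix (Fin m) (Fin n) ℝ)
    (LW : Matrix (Fin nW ⊕ Fin nP) (Fin n) ℝ) (LP : Matrix (Fin nP) (Fin n) ℝ)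
    (x0 : Ω → EuclideanSpace ℝ (Fin n)) (v : ℕ → Ω → EuclideanSpace ℝ (Fin m))
    (β : ℕ → Ω → ℝ) : ∃ x, IsClosedLoop P A BW BP H LW LP x0 v β x := by
  let next (k : ℕ) (x : ℕ → Ω → EuclideanSpace ℝ (Fin n)) (ω : Ω) : EuclideanSpace ℝ (Fin n) :=
    Matrix.toEuclideanLin A (x k ω)
      + Matrix.toEuclideanLin (combinedB BW BP) (Matrix.toEuclideanLin LW (estW P β x k ω))
      + Matrix.toEuclideanLin BP
          (Matrix.toEuclideanLin LP (estP P H v β x k ω - estW P β x k ω))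
  have hnext (k : ℕ) (x x' : ℕ → Ω → EuclideanSpace ℝ (Fin n)) (h : ∀ j ≤ k, x j = x' j) :
      next k x = next k x' := by
    have hW : estW P β x k = estW P β x' k := by
      rw [estW, estW, sigmaW_congr h, h k le_rfl]
    have hP : estP P H v β x k = estP P H v β x' k := by
      rw [estP, estP, sigmaP_congr h, h k le_rfl]
    ext1 ω
    simp only [next, hW, hP, h k le_rfl]
  -- Estimates depend on the whole past as random variables, so the recursion carries entire
  -- processes: `X k` is correct up to time `k`, its later values are placeholders, and the solution
  -- is the diagonal.
  let X : ℕ → ℕ → Ω → EuclideanSpace ℝ (Fin n) := fun k =>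
    Nat.rec (fun _ => x0) (fun k x j => if j ≤ k then x j else next k x) k
  have hXsucc (k j : ℕ) : X (k + 1) j = if j ≤ k then X k j else next k (X k) := rfl
  have hX (k j : ℕ) (hj : j ≤ k) : X k j = X j j := by
    induction k with
    | zero => rw [Nat.le_zero.1 hj]
    | succ k ih =>
      rcases Nat.le_succ_iff.1 hj with h | rfl
      · rw [hXsucc, if_pos h, ih h]
      · rfl
  refine ⟨fun k => X k k, rfl, fun k ω => ?_⟩
  have h1 : X (k + 1) (k + 1) = next k (X k) := by
    rw [hXsucc, if_neg (by omega)]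
  rw [h1, hnext k (X k) (fun k => X k k) fun j hj => hX k j hj]

end Existence

/-! ### The two Hautus conditions from mean-square stability. -/

section Stabilizability

variable {n m nW nP : ℕ} {A : Matrix (Fin n) (Fin n) ℝ} {BW : Matrix (Fin n) (Fin nW) ℝ}
  {BP : Matrix (Fin n) (Fin nP) ℝ} {H : Matrix (Fin m) (Fin n) ℝ}
  {Qv : Matrix (Fin m) (Fin m) ℝ} {p : ℝ}

/-- A mean-square stabilizable system has a stabilized closed loop from a standard Gaussian
initial state. -/
theorem IsMeanSquareStabilizable.exists_closedLoop
    (h : IsMeanSquareStabilizable A BW BP H Qv p) (hp0 : 0 ≤ p) (hp1 : p ≤ 1) :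
    ∃ (Ω : Type) (_ : MeasurableSpace Ω) (P : Measure Ω) (_ : IsProbabilityMeasure P)
      (LW : Matrix (Fin nW ⊕ Fin nP) (Fin n) ℝ) (LP : Matrix (Fin nP) (Fin n) ℝ)
      (x0 : Ω → EuclideanSpace ℝ (Fin n)) (v : ℕ → Ω → EuclideanSpace ℝ (Fin m))
      (β : ℕ → Ω → ℝ) (x : ℕ → Ω → EuclideanSpace ℝ (Fin n)),
      IsRandomData P 0 1 Qv p x0 v β ∧ IsClosedLoop P A BW BP H LW LP x0 v β x ∧
      Tendsto (fun k => ∫⁻ ω, ‖x k ω‖ₑ ^ 2 ∂P) atTop (𝓝 0) := by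
  obtain ⟨LW, LP, h⟩ := h
  obtain ⟨Ω, _, P, _, x0, v, β, hdata⟩ :=
    exists_isRandomData (0 : EuclideanSpace ℝ (Fin n)) 1 Qv hp0 hp1
  obtain ⟨x, hx⟩ := exists_isClosedLoop P A BW BP H LW LP x0 v β
  exact ⟨Ω, _, P, ‹_›, LW, LP, x0, v, β, x, hdata, hx,
    h 0 1 Matrix.PosSemidef.one Ω P x0 v β x hdata hx⟩

/-- If the state converges to zero in mean square, a functional whose second moment along the
state stays above its Gaussian second moment vanishes. -/
theorem eq_zero_of_lintegral_le {Ω : Type} [MeasurableSpace Ω] {P : Measure Ω}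
    {x : ℕ → Ω → EuclideanSpace ℝ (Fin n)}
    (hlim : Tendsto (fun k => ∫⁻ ω, ‖x k ω‖ₑ ^ 2 ∂P) atTop (𝓝 0))
    (a : EuclideanSpace ℝ (Fin n) →L[ℝ] ℂ)
    (hle : ∀ k, ∫⁻ y, ‖a y‖ₑ ^ 2 ∂stdGaussian (EuclideanSpace ℝ (Fin n)) ≤
      ‖a‖ₑ ^ 2 * ∫⁻ ω, ‖x k ω‖ₑ ^ 2 ∂P) : a = 0 := by
  by_contra ha
  have h1 : Tendsto (fun k => ‖a‖ₑ ^ 2 * ∫⁻ ω, ‖x k ω‖ₑ ^ 2 ∂P) atTop (𝓝 (‖a‖ₑ ^ 2 * 0)) :=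
    ENNReal.Tendsto.const_mul hlim (Or.inr (by simp))
  rw [mul_zero] at h1
  exact lintegral_sq_enorm_ne_zero a ha (le_bot_iff.1 (ge_of_tendsto' h1 hle))

/-- A real-linear functional on coordinate vectors, viewed on Euclidean space. -/
noncomputable def toEuclideanFunctional (a : (Fin n → ℝ) →ₗ[ℝ] ℂ) :
    EuclideanSpace ℝ (Fin n) →L[ℝ] ℂ :=
  LinearMap.toContinuousLinearMap (a ∘ₗ (WithLp.linearEquiv 2 ℝ (Fin n → ℝ)).toLinearMap)

theorem toEuclideanFunctional_toEuclideanLin {r : Type*} [Fintype r] [DecidableEq r]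
    (a : (Fin n → ℝ) →ₗ[ℝ] ℂ) (M : Matrix (Fin n) r ℝ) (y : EuclideanSpace ℝ r) :
    toEuclideanFunctional a (Matrix.toEuclideanLin M y) = a (M *ᵥ y.ofLp) := rfl

theorem eq_zero_of_toEuclideanFunctional_eq_zero {a : (Fin n → ℝ) →ₗ[ℝ] ℂ}
    (h : toEuclideanFunctional a = 0) : a = 0 :=
  LinearMap.ext fun y => DFunLike.congr_fun h (WithLp.toLp 2 y)

/-- Necessity of stabilizability of `(A, [B^W B^P])`. -/
theorem IsMeanSquareStabilizable.hautus_combined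
    (h : IsMeanSquareStabilizable A BW BP H Qv p) (hp0 : 0 ≤ p) (hp1 : p ≤ 1)
    (c : ℂ) (a : (Fin n → ℝ) →ₗ[ℝ] ℂ) (hc : 1 ≤ ‖c‖) (hA : ∀ x, a (A *ᵥ x) = c * a x)
    (hB : ∀ u, a (combinedB BW BP *ᵥ u) = 0) : a = 0 := by
  obtain ⟨Ω, _, P, _, LW, LP, x0, v, β, x, hdata, hx, hlim⟩ := h.exists_closedLoop hp0 hp1
  refine eq_zero_of_toEuclideanFunctional_eq_zero (eq_zero_of_lintegral_le hlim _ fun k => ?_)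
  set b := toEuclideanFunctional a with hb
  have hBP (u : Fin nP → ℝ) : a (BP *ᵥ u) = 0 := by
    have := hB (Sum.elim 0 u)
    rwa [combinedB, Matrix.fromCols_mulVec_sumElim, Matrix.mulVec_zero, zero_add] at this
  have hbx := apply_eq_of_annihilates_input hx b c (fun y => hA _) (fun u => hB _)
    (fun u => hBP _) k
  rw [← lintegral_const_mul' _ _ (by simp), ← multivariateGaussian_zero_one,
    ← hdata.law_x0.lintegral_comp (f := fun y => ‖b y‖ₑ ^ 2) (by fun_prop)]
  refine lintegral_mono fun ω => ?_
  rw [← mul_pow]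
  gcongr
  refine le_trans ?_ (b.le_opENorm (x k ω))
  rw [hbx, enorm_mul, enorm_pow]
  refine le_mul_of_one_le_left zero_le (one_le_pow₀ ?_)
  rw [← ofReal_norm]
  exact ENNReal.one_le_ofReal.2 hc

/-- Necessity of stabilizability of `(√p A, B^P)`. -/
theorem IsMeanSquareStabilizable.hautus_embedded
    (h : IsMeanSquareStabilizable A BW BP H Qv p) (hp0 : 0 ≤ p) (hp1 : p ≤ 1)
    (c : ℂ) (a : (Fin n → ℝ) →ₗ[ℝ] ℂ) (hc : 1 ≤ ‖c‖)
    (hA : ∀ x, a ((√p • A) *ᵥ x) = c * a x)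
    (hB : ∀ u, a (BP *ᵥ u) = 0) : a = 0 := by
  -- For `p = 0` the matrix `√p A` is zero and `c ≠ 0`, so `a = 0` at once.
  rcases hp0.eq_or_lt with rfl | hp
  · have hc0 : c ≠ 0 := norm_pos_iff.1 (one_pos.trans_le hc)
    refine LinearMap.ext fun x => ?_
    have := hA x
    simpa [hc0] using this
  have hs : 0 < √p := Real.sqrt_pos.2 hp
  have hsc : ((√p : ℝ) : ℂ) ≠ 0 := by exact_mod_cast hs.ne'
  obtain ⟨Ω, _, P, _, LW, LP, x0, v, β, x, hdata, hx, hlim⟩ := h.exists_closedLoop hp0 hp1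
  refine eq_zero_of_toEuclideanFunctional_eq_zero (eq_zero_of_lintegral_le hlim _ fun k => ?_)
  -- The eigenvalue for `A` itself is `c / √p`, and `p |c / √p|² = |c|² ≥ 1`.
  have hA' (y : EuclideanSpace ℝ (Fin n)) : toEuclideanFunctional a (Matrix.toEuclideanLin A y) =
      c / √p * toEuclideanFunctional a y := by
    have := hA y.ofLp
    rw [Matrix.smul_mulVec, map_smul, Complex.real_smul] at this
    rw [toEuclideanFunctional_toEuclideanLin, div_mul_eq_mul_div, eq_div_iff hsc, mul_comm, this]
    rfl
  obtain ⟨d, hd⟩ := exists_forall_loss_apply_eq hx _ _ hA' (fun u => hB _) k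
  refine lintegral_le_of_annihilates hp0 hdata _ _ d ?_ k hd
  rw [norm_div, Complex.norm_real, Real.norm_of_nonneg hs.le, div_pow, Real.sq_sqrt hp0,
    mul_div_cancel₀ _ hp.ne']
  exact one_le_pow₀ hc

end Stabilizability

/-! ### Weights and assembly of the coupled solution. -/

theorem combinedR_posDef {nW nP : ℕ} {RW : Matrix (Fin nW) (Fin nW) ℝ}
    {RP : Matrix (Fin nP) (Fin nP) ℝ} (hRW : RW.PosDef) (hRP : RP.PosDef) :
    (combinedR RW RP).PosDef := by
  refine Matrix.PosDef.of_dotProduct_mulVec_pos ?_ fun {x} hx => ?_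
  · exact Matrix.IsHermitian.fromBlocks hRW.1 (by simp) hRP.1
  · have hx' : x = Sum.elim (x ∘ Sum.inl) (x ∘ Sum.inr) := (Sum.elim_comp_inl_inr x).symm
    rw [star_trivial, combinedR, Matrix.fromBlocks_mulVec]
    conv_rhs => enter [1]; rw [hx']
    rw [sumElim_dotProduct_sumElim]
    simp only [Matrix.zero_mulVec, add_zero, zero_add]
    have h1 := quadratic_nonneg hRW.posSemidef (x ∘ Sum.inl)
    have h2 := quadratic_nonneg hRP.posSemidef (x ∘ Sum.inr)
    by_cases h0 : x ∘ Sum.inl = 0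
    · have h3 : x ∘ Sum.inr ≠ 0 := fun h3 => hx (by rw [hx', h0, h3]; ext (i | i) <;> rfl)
      have := hRP.dotProduct_mulVec_pos h3
      rw [star_trivial] at this
      linarith
    · have := hRW.dotProduct_mulVec_pos h0
      rw [star_trivial] at this
      linarith

theorem sqrt_mulVec_eq_zero_of_quadratic_eq_zero {n : ℕ} {Q : Matrix (Fin n) (Fin n) ℝ}
    (hQ : Q.PosSemidef) {y : Fin n → ℝ} (hy : y ⬝ᵥ Q *ᵥ y = 0) : CFC.sqrt Q *ᵥ y = 0 := by
  have hsq : CFC.sqrt Q * CFC.sqrt Q = Q := CFC.sqrt_mul_sqrt_self Q hQ.nonneg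
  have hsymm : (CFC.sqrt Q)ᵀ = CFC.sqrt Q :=
    transpose_eq_of_isHermitian (Matrix.nonneg_iff_posSemidef.1 (CFC.sqrt_nonneg Q)).1
  rw [← hsq, ← Matrix.mulVec_mulVec] at hy
  nth_rw 1 [← hsymm] at hy
  rw [dotProduct_transpose_mulVec] at hy
  exact dotProduct_self_eq_zero.1 hy

end NCS

theorem theorem2 {n m nW nP : ℕ}
    (A : Matrix (Fin n) (Fin n) ℝ) (BW : Matrix (Fin n) (Fin nW) ℝ)
    (BP : Matrix (Fin n) (Fin nP) ℝ) (H : Matrix (Fin m) (Fin n) ℝ)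
    (Qv : Matrix (Fin m) (Fin m) ℝ) (hQv : Qv.PosSemidef)
    (p : ℝ) (hp0 : 0 ≤ p) (hp1 : p ≤ 1)
    (Q : Matrix (Fin n) (Fin n) ℝ) (RW : Matrix (Fin nW) (Fin nW) ℝ)
    (RP : Matrix (Fin nP) (Fin nP) ℝ)
    (hRP : RP.PosDef) (hRW : RW.PosDef)
    (hQ : ∃ (r : ℕ) (D : Matrix (Fin r) (Fin n) ℝ), Q = Dᵀ * D)
    (hobs : NCS.IsObservable A (CFC.sqrt Q)) (hdet : NCS.IsDetectable A H)
    (hstab : NCS.IsMeanSquareStabilizable A BW BP H Qv p) :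
    ∃ PW PP : Matrix (Fin n) (Fin n) ℝ,
      NCS.RiccatiW A BW BP Q RW RP PW ∧ NCS.RiccatiP A BP Q RP p PW PP ∧
      PW.PosDef ∧ (NCS.Del p PW PP).PosDef := by
  have hQpos : Q.PosSemidef := by
    obtain ⟨r, D, rfl⟩ := hQ
    simpa using Matrix.posSemidef_conjTranspose_mul_self D
  have hobsQ (x : Fin n → ℝ) (hx : ∀ k : ℕ, (A ^ k *ᵥ x) ⬝ᵥ Q *ᵥ (A ^ k *ᵥ x) = 0) : x = 0 :=
    hobs x fun k => NCS.sqrt_mulVec_eq_zero_of_quadratic_eq_zero hQpos (hx k)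
  obtain ⟨PW, hPW, hPWfix⟩ := NCS.exists_posDef_riccatiMap_eq hQpos
    (NCS.combinedR_posDef hRW hRP) (hstab.hautus_combined hp0 hp1) hobsQ
  have hp1' : 0 ≤ 1 - p := sub_nonneg.2 hp1
  -- The decoupled equation for `Δ`. For `p = 1` its observability is that of `(A, Q)`; for `p < 1`
  -- the weight dominates `(1 - p) P^W > 0`, so time `0` alone suffices.
  obtain ⟨Δ, hΔ, hΔfix⟩ := NCS.exists_posDef_riccatiMap_eq
    (Q := p • Q + (1 - p) • PW) ((hQpos.smul hp0).add (hPW.posSemidef.smul hp1')) hRP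
    (hstab.hautus_embedded hp0 hp1) (fun x hx => by
      rcases hp1.eq_or_lt with rfl | hlt
      · exact hobsQ x fun k => by simpa using hx k
      · by_contra hne
        have h0 := hx 0
        have h1 := hPW.dotProduct_mulVec_pos hne
        have h2 := NCS.quadratic_nonneg hQpos x
        simp only [pow_zero, Matrix.one_mulVec, Matrix.add_mulVec, Matrix.smul_mulVec,
          dotProduct_add, dotProduct_smul, smul_eq_mul] at h0
        rw [star_trivial] at h1
        nlinarith [mul_pos (sub_pos.2 hlt) h1, mul_nonneg hp0 h2])
  have hDel : NCS.Del p PW (NCS.riccatiMap A BP Q RP Δ) = Δ := by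
    conv_rhs => rw [hΔfix]
    simp only [NCS.Del, NCS.riccatiMap, Matrix.transpose_smul, Matrix.smul_mul, Matrix.mul_smul,
      smul_smul, Real.mul_self_sqrt hp0, smul_add, smul_sub]
    abel
  refine ⟨PW, NCS.riccatiMap A BP Q RP Δ, hPWfix, ?_, hPW, by rwa [hDel]⟩
  rw [NCS.RiccatiP, hDel]
  rfl
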